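/- Let $A,B\in\mathbb R$. On the Schwartz space $\mathcal D=\mathcal S(\mathbb R^2)\subset\mathcal H=L^2(\mathbb R^2)$ let $x_1,x_2$ be the position operators and $p_j=-i\,\partial/\partial x_j$. For $\theta,\tilde\theta\in\mathbb R$ put $$\hat x_1=x_1-\tfrac12\theta p_2,\quad \hat x_2=x_2+\tfrac12\theta p_1,\quad \hat p_1=p_1+\tfrac12\tilde\theta x_2,\quad \hat p_2=p_2-\tfrac12\tilde\theta x_1,$$ $$\hat H=\tfrac12(\hat p_1^2+\hat x_1^2)+\tfrac12(\hat p_2^2+\hat x_2^2)+i\left[A(\hat x_1+\hat x_2)+B(\hat p_1+\hat p_2)\right],$$ $X_j=x_j+iA_j$, $P_j=p_j+iB_j$ with $A_1=A+\frac12\theta B$, $A_2=A-\frac12\theta B$, $B_1=B-\frac12\tilde\theta A$, $B_2=B+\frac12\tilde\theta A$, and $$a_1=\tfrac12(X_1+iP_1+iX_2-P_2),\quad a_2=\tfrac12(-iX_1+P_1-X_2-iP_2),$$ $$b_1=\tfrac12(X_1-iP_1-iX_2-P_2),\quad b_2=\tfrac12(iX_1+P_1-X_2+iP_2),\qquad N_j=b_ja_j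 .$$ Write $F\equiv G$ if $F-G$ is a polynomial in $\theta,\tilde\theta$, with operators on $\mathcal S(\mathbb R^2)$ as coefficients, all of whose monomials have degree at least $2$. All adjoints are taken in $L^2(\mathbb R^2)$, of operators with domain $\mathcal S(\mathbb R^2)$. (1) With $\epsilon_{12}=-\epsilon_{21}=1$, $\epsilon_{jj}=0$: $[\hat x_j,\hat p_k]\equiv i\delta_{jk}$, $[\hat x_j,\hat x_k]\equiv i\theta\epsilon_{jk}$, $[\hat p_j,\hat p_k]\equiv i\tilde\theta\epsilon_{jk}$, and $$\hat H\equiv\tfrac12(p_1^2+x_1^2)+\tfrac12(p_2^2+x_2^2)+i[A(x_1+x_2)+B(p_1+p_2)]+\tfrac12(\theta+\tilde\theta)(p_1x_2-p_2x_1)+i\left[\tfrac{A\theta}2(p_1-p_2)-\tfrac{B\tilde\theta}2(x_1-x_2)\right],$$ $$\hat H\equiv(N_1+N_2+1)+\tfrac12(\theta+\tilde\theta)(N_1-N_2)+(A^2+B^2).$$ Now fix any $\theta,\tilde\theta\in\mathbb R$ and let $$k_1=A(1-\tfrac{\tilde\theta}2)(i-1)+B(\tfrac\theta2-1)(i+1),\qquad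 k_2=A(1+\tfrac{\tilde\theta}2)(1-i)+B(\tfrac\theta2+1)(i+1),$$ $\alpha_1=\frac{k_1+ik_2}2$, $\alpha_2=\frac{k_1-ik_2}{2i}$. (2) $(a_j,b_j)_{j=1,2}$ are $\mathcal D$-pseudo-bosonic: $\mathcal D$ is dense in $\mathcal H$ and stable under $a_j,b_j,a_j^\dagger,b_j^\dagger$, and on $\mathcal D$ one has $[a_j,b_k]=\delta_{jk}$, $[a_j,a_k]=[b_j,b_k]=0$. If $k_j\neq0$ then $b_j\ne a_j^\dagger$ on $\mathcal D$. The functions $\varphi_{0,0}=Ne^{-\frac12(x_1^2+x_2^2)-\alpha_1x_1-\alpha_2x_2}$ and $\Psi_{0,0}=N'e^{-\frac12(x_1^2+x_2^2)+\alpha_1x_1+\alpha_2x_2}$ ($N,N'\in\mathbb C$) belong to $\mathcal D$ and satisfy $a_j\varphi_{0,0}=0=b_j^\dagger\Psi_{0,0}$, and so all the vectors $$\varphi_{n_1,n_2}=\frac{b_1^{n_1}b_2^{n_2}\varphi_{0,0}}{\sqrt{n_1!\,n_2!}},\qquad \Psi_{n_1,n_2}=\frac{(a_1^\dagger)^{n_1}(a_2^\dagger)^{n_2}\Psi_{0,0}}{\sqrt{n_1!\,n_2!}}$$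 belong to $\mathcal D$. (3) Let $c_j=\frac1{\sqrt2}(x_j+ip_j)$, $c_g=\frac1{\sqrt2}(c_1+ic_2)$, $c_d=\frac{-i}{\sqrt2}(c_1-ic_2)$. On $\mathcal D$, which is stable under $c_g,c_d,c_g^\dagger,c_d^\dagger$, one has $[c_g,c_g^\dagger]=[c_d,c_d^\dagger]=1$, and the other commutators vanish. The function $\chi_{0,0}=\pi^{-1/2}e^{-\frac12(x_1^2+x_2^2)}$ belongs to $\mathcal D$ and is annihilated by $c_g$ and $c_d$, and the vectors $\chi_{n_1,n_2}=\frac1{\sqrt{n_1!\,n_2!}}(c_g^\dagger)^{n_1}(c_d^\dagger)^{n_2}\chi_{0,0}$, $n_j\ge0$, form an orthonormal basis of $\mathcal H$. (4) The operator $-\frac12(k_1c_g^\dagger+k_2c_d^\dagger+\overline{k_1}c_g+\overline{k_2}c_d)$ with domain $\mathcal D$ has a self-adjoint closure. Let $$T=\exp\left\{-\tfrac12\left(k_1c_g^\dagger+k_2c_d^\dagger+\overline{k_1}\,c_g+\overline{k_2}\,c_d\right)\right\}$$ be the exponential of this closure in the sense of the functional calculus of self-adjoint operators. Then $T$ is self-adjoint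 and injective, it is unbounded if $(A,B)\neq(0,0)$, and $\chi_{n_1,n_2}\in D(T)\cap D(T^{-1})$ for all $n_1,n_2$. One can choose $N,N'$ with $\langle\varphi_{0,0},\Psi_{0,0}\rangle=1$ such that, for all $n_1,n_2\ge0$, $$\varphi_{n_1,n_2}=T\chi_{n_1,n_2},\qquad\Psi_{n_1,n_2}=T^{-1}\chi_{n_1,n_2};$$ for every other choice of $N,N'$ with $\langle\varphi_{0,0},\Psi_{0,0}\rangle=1$ there is a constant $c\neq0$ with $\varphi_{n_1,n_2}=c\,T\chi_{n_1,n_2}$ and $\Psi_{n_1,n_2}=\overline c^{\,-1}T^{-1}\chi_{n_1,n_2}$ for all $n_1,n_2$. (5) For every choice of $N,N'$ with $\langle\varphi_{0,0},\Psi_{0,0}\rangle=1$ the families $\mathcal F_\varphi=\{\varphi_{n_1,n_2}\}$ and $\mathcal F_\Psi=\{\Psi_{n_1,n_2}\}$ are biorthonormal, and they are $\mathcal G$-quasi bases for $\mathcal G=D(T)\cap D(T^{-1})$: $\mathcal G$ is dense in $\mathcal H$, it contains all $\varphi_{n_1,n_2}$ and $\Psi_{n_1,n_2}$, and for all $f,g\in\mathcal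 G$ $$\langle f,g\rangle=\sum_{n_1,n_2\ge0}\langle f,\varphi_{n_1,n_2}\rangle\langle\Psi_{n_1,n_2},g\rangle=\sum_{n_1,n_2\ge0}\langle f,\Psi_{n_1,n_2}\rangle\langle\varphi_{n_1,n_2},g\rangle .$$ -/

import Mathlib

open MeasureTheory Complex
open scoped SchwartzMap ComplexConjugate InnerProductSpace

noncomputable section

namespace NCPB

/-! ### Pseudo-bosons on a general Hilbert space -/

section General

variable {H : Type*} [NormedAddCommGroup H] [InnerProductSpace ℂ H] [CompleteSpace H]

open Classical in
/-- The value `A f` of a partially defined operator (and `0` outside of its domain). It is only used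
on vectors that the surrounding statements show to be in the domain. -/
def ev (A : H →ₗ.[ℂ] H) (f : H) : H :=
  if h : f ∈ A.domain then A ⟨f, h⟩ else 0

/-- `D ⊆ D(A)` and `A D ⊆ D`. -/
def Stable (A : H →ₗ.[ℂ] H) (D : Submodule ℂ H) : Prop :=
  D ≤ A.domain ∧ ∀ f ∈ D, ev A f ∈ D

/-- Two-mode `D`-pseudo-bosonic operators: `D` is dense, it is stable under `a_j`, `b_j` and their
adjoints, and on `D` one has `[a_j, b_k] = δ_{jk}` while the other commutators vanish. -/
structure IsPseudoBosonic (D : Submodule ℂ H) (a b : Fin 2 → H →ₗ.[ℂ] H) : Prop where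
  dense : Dense (D : Set H)
  stable_a : ∀ j, Stable (a j) D
  stable_b : ∀ j, Stable (b j) D
  stable_a_adjoint : ∀ j, Stable (a j).adjoint D
  stable_b_adjoint : ∀ j, Stable (b j).adjoint D
  comm_ab : ∀ j k, ∀ f ∈ D,
    ev (a j) (ev (b k) f) - ev (b k) (ev (a j) f) = if j = k then f else 0
  comm_aa : ∀ j k, ∀ f ∈ D, ev (a j) (ev (a k) f) - ev (a k) (ev (a j) f) = 0
  comm_bb : ∀ j k, ∀ f ∈ D, ev (b j) (ev (b k) f) - ev (b k) (ev (b j) f) = 0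

/-- `(n₁! n₂!)^{-1/2} A₁^{n₁} A₂^{n₂} v`. -/
def ladder (A : Fin 2 → H →ₗ.[ℂ] H) (v : H) (n : ℕ × ℕ) : H :=
  (((Real.sqrt (n.1.factorial * n.2.factorial))⁻¹ : ℝ) : ℂ) •
    (ev (A 0))^[n.1] ((ev (A 1))^[n.2] v)

/-- `φ` and `Ψ` are `G`-quasi bases: `G` is dense, contains all the `φ_n` and `Ψ_n`, and
`⟨f, g⟩ = ∑ ⟨f, φ_n⟩ ⟨Ψ_n, g⟩ = ∑ ⟨f, Ψ_n⟩ ⟨φ_n, g⟩` for all `f, g ∈ G`. -/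
structure IsQuasiBases {ι : Type*} (G : Submodule ℂ H) (φ Ψ : ι → H) : Prop where
  dense : Dense (G : Set H)
  mem_left : ∀ n, φ n ∈ G
  mem_right : ∀ n, Ψ n ∈ G
  hasSum_left : ∀ f ∈ G, ∀ g ∈ G, HasSum (fun n => ⟪f, φ n⟫_ℂ * ⟪Ψ n, g⟫_ℂ) ⟪f, g⟫_ℂ
  hasSum_right : ∀ f ∈ G, ∀ g ∈ G, HasSum (fun n => ⟪f, Ψ n⟫_ℂ * ⟪φ n, g⟫_ℂ) ⟪f, g⟫_ℂ

/-- `A = U⁻¹ M_g U`, where `M_g` is the operator of multiplication by the real function `g` on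
`L²(μ)`, with its maximal domain. -/
def IsMultiplication {X : Type*} [MeasurableSpace X] {μ : Measure X}
    (U : H ≃ₗᵢ[ℂ] Lp ℂ 2 μ) (g : X → ℝ) (A : H →ₗ.[ℂ] H) : Prop :=
  ∀ h k : H, (h, k) ∈ A.graph ↔ (U k : X → ℂ) =ᵐ[μ] fun x => (g x : ℂ) * (U h : X → ℂ) x

/-- `T = exp K` in the sense of the functional calculus of self-adjoint operators: in a spectral
representation in which `K` is multiplication by the real measurable function `g`, the operator `T`
is multiplication by `exp ∘ g`. -/
def IsExp (K T : H →ₗ.[ℂ] H) : Prop :=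
  ∃ (X : Type) (_ : MeasurableSpace X) (μ : Measure X) (U : H ≃ₗᵢ[ℂ] Lp ℂ 2 μ) (g : X → ℝ),
    Measurable g ∧ IsMultiplication U g K ∧ IsMultiplication U (fun x => Real.exp (g x)) T

end General

/-! ### Operators on `𝓢(ℝ²)` and `L²(ℝ²)` -/

/-- The plane `ℝ²`; the two coordinates are indexed by `0` and `1`. -/
abbrev Plane := EuclideanSpace ℝ (Fin 2)

/-- The Hilbert space `L²(ℝ²)`. -/
abbrev Hil := Lp ℂ 2 (volume : Measure Plane)

/-- The algebra of continuous linear operators on `𝓢(ℝ²)`. -/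
abbrev SOp := 𝓢(Plane, ℂ) →L[ℂ] 𝓢(Plane, ℂ)

/-- The inclusion of `𝓢(ℝ²)` in `L²(ℝ²)`. -/
def incl : 𝓢(Plane, ℂ) →ₗ[ℂ] Hil := (SchwartzMap.toLpCLM ℂ ℂ 2 volume).toLinearMap

theorem incl_injective : Function.Injective incl := SchwartzMap.injective_toLp 2 volume

/-- `𝓢(ℝ²)` as a subspace of `L²(ℝ²)`. -/
def schwartzD : Submodule ℂ Hil := LinearMap.range incl

/-- An operator on `𝓢(ℝ²)`, as an operator on `L²(ℝ²)` with domain `𝓢(ℝ²)`. -/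
def toPMap (A : SOp) : Hil →ₗ.[ℂ] Hil where
  domain := schwartzD
  toFun := incl ∘ₗ A.toLinearMap ∘ₗ (LinearEquiv.ofInjective incl incl_injective).symm.toLinearMap

/-- The position operators `x_j`. -/
def x (j : Fin 2) : SOp := SchwartzMap.smulLeftCLM ℂ (fun v : Plane => ((v j : ℝ) : ℂ))

/-- The momentum operators `p_j = -i ∂/∂x_j`. -/
def p (j : Fin 2) : SOp :=
  (-I) • LineDeriv.lineDerivOpCLM ℂ 𝓢(Plane, ℂ) (EuclideanSpace.single j (1 : ℝ))

/-! ### The noncommutative model; `s` and `t` stand for `θ` and `θ̃` -/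

/-- The operators `x̂_j`. -/
def xHat (s : ℝ) : Fin 2 → SOp :=
  ![x 0 - ((s / 2 : ℝ) : ℂ) • p 1, x 1 + ((s / 2 : ℝ) : ℂ) • p 0]

/-- The operators `p̂_j`. -/
def pHat (t : ℝ) : Fin 2 → SOp :=
  ![p 0 + ((t / 2 : ℝ) : ℂ) • x 1, p 1 - ((t / 2 : ℝ) : ℂ) • x 0]

/-- The antisymmetric symbol. -/
def eps (j k : Fin 2) : ℂ := ((k : ℕ) : ℂ) - ((j : ℕ) : ℂ)

/-- The Hamiltonian `Ĥ` in terms of the operators `x̂_j`, `p̂_j`. -/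
def hHat (A B s t : ℝ) : SOp :=
  (1 / 2 : ℂ) • (pHat t 0 ^ 2 + xHat s 0 ^ 2) + (1 / 2 : ℂ) • (pHat t 1 ^ 2 + xHat s 1 ^ 2)
    + I • ((A : ℂ) • (xHat s 0 + xHat s 1) + (B : ℂ) • (pHat t 0 + pHat t 1))

/-- The Hamiltonian `Ĥ` truncated to first order in `θ` and `θ̃`. -/
def hTrunc (A B s t : ℝ) : SOp :=
  (1 / 2 : ℂ) • (p 0 ^ 2 + x 0 ^ 2) + (1 / 2 : ℂ) • (p 1 ^ 2 + x 1 ^ 2)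
    + I • ((A : ℂ) • (x 0 + x 1) + (B : ℂ) • (p 0 + p 1))
    + (((s + t) / 2 : ℝ) : ℂ) • (p 0 * x 1 - p 1 * x 0)
    + I • (((A * s / 2 : ℝ) : ℂ) • (p 0 - p 1) - ((B * t / 2 : ℝ) : ℂ) • (x 0 - x 1))

/-- Equality up to terms of order at least two in `(θ, θ̃)`: the difference is a polynomial in
`θ, θ̃`, with operators on `𝓢(ℝ²)` as coefficients, all of whose monomials have degree at least
two. -/
def EqModQuadratic (F G : ℝ → ℝ → SOp) : Prop :=
  ∃ R : (ℕ × ℕ) →₀ SOp, (∀ i ∈ R.support, 2 ≤ i.1 + i.2) ∧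
    ∀ s t : ℝ, F s t - G s t = R.sum fun i r => ((s ^ i.1 * t ^ i.2 : ℝ) : ℂ) • r

/-- The operators `X_j = x_j + i A_j`. -/
def X (A B s : ℝ) : Fin 2 → SOp :=
  ![x 0 + (I * ((A + s * B / 2 : ℝ) : ℂ)) • 1, x 1 + (I * ((A - s * B / 2 : ℝ) : ℂ)) • 1]

/-- The operators `P_j = p_j + i B_j`. -/
def P (A B t : ℝ) : Fin 2 → SOp :=
  ![p 0 + (I * ((B - t * A / 2 : ℝ) : ℂ)) • 1, p 1 + (I * ((B + t * A / 2 : ℝ) : ℂ)) • 1]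

/-- The pseudo-bosonic operators `a_1, a_2`, on `𝓢(ℝ²)`. -/
def aS (A B s t : ℝ) : Fin 2 → SOp :=
  ![(1 / 2 : ℂ) • (X A B s 0 + I • P A B t 0 + I • X A B s 1 - P A B t 1),
    (1 / 2 : ℂ) • (-(I • X A B s 0) + P A B t 0 - X A B s 1 - I • P A B t 1)]

/-- The pseudo-bosonic operators `b_1, b_2`, on `𝓢(ℝ²)`. -/
def bS (A B s t : ℝ) : Fin 2 → SOp :=
  ![(1 / 2 : ℂ) • (X A B s 0 - I • P A B t 0 - I • X A B s 1 - P A B t 1),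
    (1 / 2 : ℂ) • (I • X A B s 0 + P A B t 0 - X A B s 1 + I • P A B t 1)]

/-- The number-like operators `N_j = b_j a_j`, on `𝓢(ℝ²)`. -/
def N (A B s t : ℝ) (j : Fin 2) : SOp := bS A B s t j * aS A B s t j

/-- `(N_1 + N_2 + 1) + ½ (θ + θ̃) (N_1 - N_2) + (A² + B²)`. -/
def hNumber (A B s t : ℝ) : SOp :=
  (N A B s t 0 + N A B s t 1 + 1) + (((s + t) / 2 : ℝ) : ℂ) • (N A B s t 0 - N A B s t 1)
    + ((A ^ 2 + B ^ 2 : ℝ) : ℂ) • 1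

/-- `a_1, a_2` as operators on `L²(ℝ²)`. -/
def a (A B s t : ℝ) (j : Fin 2) : Hil →ₗ.[ℂ] Hil := toPMap (aS A B s t j)

/-- `b_1, b_2` as operators on `L²(ℝ²)`. -/
def b (A B s t : ℝ) (j : Fin 2) : Hil →ₗ.[ℂ] Hil := toPMap (bS A B s t j)

/-- The constants `k_1, k_2`. -/
def kc (A B s t : ℝ) : Fin 2 → ℂ :=
  ![A * (1 - t / 2) * (I - 1) + B * (s / 2 - 1) * (I + 1),
    A * (1 + t / 2) * (1 - I) + B * (s / 2 + 1) * (I + 1)]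

/-- The constants `α_1, α_2`. -/
def alpha (A B s t : ℝ) : Fin 2 → ℂ :=
  ![(kc A B s t 0 + I * kc A B s t 1) / 2, (kc A B s t 0 - I * kc A B s t 1) / (2 * I)]

/-- The function `exp(-½(x_1² + x_2²) - β_1 x_1 - β_2 x_2)`. -/
def gaussFun (β : Fin 2 → ℂ) (v : Plane) : ℂ :=
  cexp (-(1 / 2) * ((v 0 : ℂ) ^ 2 + (v 1 : ℂ) ^ 2) - β 0 * (v 0 : ℂ) - β 1 * (v 1 : ℂ))

theorem memLp_gaussFun (β : Fin 2 → ℂ) : MemLp (gaussFun β) 2 (volume : Measure Plane) := by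
  have hc : Continuous (gaussFun β) := by unfold gaussFun; fun_prop
  rw [memLp_two_iff_integrable_sq_norm hc.aestronglyMeasurable]
  have h := (GaussianFourier.integrable_cexp_neg_mul_sq_norm_add (b := 1) (by simp) (-2)
    (!₂[(β 0).re, (β 1).re] : Plane)).norm
  refine h.congr (Filter.Eventually.of_forall fun v => ?_)
  simp only [gaussFun, Complex.norm_exp, ← Real.exp_nat_mul]
  congr 1
  have h1 : ‖v‖ ^ 2 = v 0 ^ 2 + v 1 ^ 2 := by
    simp [EuclideanSpace.norm_sq_eq, Fin.sum_univ_two]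
  have h2 : ⟪(!₂[(β 0).re, (β 1).re] : Plane), v⟫_ℝ = v 0 * (β 0).re + v 1 * (β 1).re := by
    simp [PiLp.inner_apply, Fin.sum_univ_two]
  rw [h2]
  norm_cast
  rw [h1]
  simp [-Complex.ofReal_pow]
  ring

/-- The same function as an element of `L²(ℝ²)`. -/
def gauss (β : Fin 2 → ℂ) : Hil := (memLp_gaussFun β).toLp (gaussFun β)

/-- The vacuum `φ_{0,0} = M exp(-½(x_1² + x_2²) - α_1 x_1 - α_2 x_2)`. -/
def phi0 (A B s t : ℝ) (M : ℂ) : Hil := M • gauss (alpha A B s t)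

/-- The vacuum `Ψ_{0,0} = M' exp(-½(x_1² + x_2²) + α_1 x_1 + α_2 x_2)`. -/
def psi0 (A B s t : ℝ) (M' : ℂ) : Hil := M' • gauss (-alpha A B s t)

/-- `φ_{n_1,n_2} = (n_1! n_2!)^{-1/2} b_1^{n_1} b_2^{n_2} φ_{0,0}`. -/
def phi (A B s t : ℝ) (M : ℂ) : ℕ × ℕ → Hil := ladder (b A B s t) (phi0 A B s t M)

/-- `Ψ_{n_1,n_2} = (n_1! n_2!)^{-1/2} (a_1†)^{n_1} (a_2†)^{n_2} Ψ_{0,0}`. -/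
def psi (A B s t : ℝ) (M' : ℂ) : ℕ × ℕ → Hil :=
  ladder (fun j => (a A B s t j).adjoint) (psi0 A B s t M')

/-! ### The bosonic operators `c_g`, `c_d` and the exponent of `T` -/

/-- `c_j = (x_j + i p_j) / √2`, on `𝓢(ℝ²)`. -/
def cS (j : Fin 2) : SOp := ((1 / Real.sqrt 2 : ℝ) : ℂ) • (x j + I • p j)

/-- `c_g = (c_1 + i c_2) / √2` and `c_d = -i (c_1 - i c_2) / √2`, in this order. -/
def cgd : Fin 2 → Hil →ₗ.[ℂ] Hil :=
  ![toPMap (((1 / Real.sqrt 2 : ℝ) : ℂ) • (cS 0 + I • cS 1)),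
    toPMap ((-I * ((1 / Real.sqrt 2 : ℝ) : ℂ)) • (cS 0 - I • cS 1))]

/-- The normalized vacuum `χ_{0,0}` of the two-dimensional harmonic oscillator. -/
def chi0 : Hil := ((1 / Real.sqrt Real.pi : ℝ) : ℂ) • gauss 0

/-- `χ_{n_1,n_2} = (n_1! n_2!)^{-1/2} (c_g†)^{n_1} (c_d†)^{n_2} χ_{0,0}`. -/
def chi : ℕ × ℕ → Hil := ladder (fun j => (cgd j).adjoint) chi0

/-- The exponent `-½ (k_1 c_g† + k_2 c_d† + conj(k_1) c_g + conj(k_2) c_d)`; as the operators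
`c_g`, `c_d` have domain `𝓢(ℝ²)`, so has the sum. -/
def exponent (A B s t : ℝ) : Hil →ₗ.[ℂ] Hil :=
  (-(1 / 2) : ℂ) • (kc A B s t 0 • (cgd 0).adjoint + kc A B s t 1 • (cgd 1).adjoint
    + conj (kc A B s t 0) • cgd 0 + conj (kc A B s t 1) • cgd 1)

end NCPB

end

/-!
On Schwartz functions, the exponent of `T` is a real linear combination `K` of the `x_j` and
`p_j`. A phase and partial Fourier transforms turn `K` into multiplication by a linear function,
so its closure is self-adjoint. The curves `e^{τ K} χ_n` are written down explicitly, as creation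
operators applied to Gaussians that depend on `τ`, and they solve `f' = K f`. In a spectral
representation of the closure of `K`, where it becomes multiplication by a function `g`, a
solution is `e^{τ g}` times its initial value, because the generator is bounded where `|g| ≤ n`;
hence `(f τ, f (τ + 1))` lies in the graph of `T`. Up to one common constant, `φ_n` and `Ψ_n` are
the values of `e^{τ K} χ_n` at `τ = 1` and `τ = -1`, so biorthonormality and the quasi-basis
identities follow from the symmetry of `T` and from the orthonormal basis `χ`. That basis is
complete because a function orthogonal to all polynomials times the Gaussian is orthogonal to
every `exp (-½ (x₁² + x₂²) - β₁ x₁ - β₂ x₂)`, so that its product with the Gaussian has zero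
Fourier transform.
-/

noncomputable section

namespace NCPB

open scoped ENNReal

section BoundedOperators

variable {E : Type*} [NormedAddCommGroup E] [NormedSpace ℂ E] [CompleteSpace E]

theorem eq_exp_smul_apply_of_hasDerivAt {G : E →L[ℂ] E} {u : ℝ → E}
    (hu : ∀ τ, HasDerivAt u (G (u τ)) τ) (τ : ℝ) : u τ = NormedSpace.exp (τ • G) (u 0) := by
  have hexp (τ : ℝ) : HasDerivAt (fun σ : ℝ => NormedSpace.exp (σ • G) (u 0))
      (G (NormedSpace.exp (τ • G) (u 0))) τ :=
    ((ContinuousLinearMap.apply ℂ E (u 0)).restrictScalars ℝ).hasFDerivAt.comp_hasDerivAt τ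
      (hasDerivAt_exp_smul_const' (𝕂 := ℝ) G τ)
  have huniq := ODE_solution_unique_univ (v := fun _ => G) (s := fun _ => Set.univ) (t₀ := 0)
    (fun _ => G.lipschitz.lipschitzOnWith) (fun τ => ⟨hu τ, trivial⟩) (fun τ => ⟨hexp τ, trivial⟩)
    (by simp)
  exact congrFun huniq τ

end BoundedOperators

section BoundedMultiplication

variable {X : Type*} [MeasurableSpace X] {μ : Measure X}

theorem coeFn_sum_smul {p : ℝ≥0∞} {ι : Type*} (s : Finset ι) (c : ι → ℂ) (f : ι → Lp ℂ p μ) :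
    (∑ i ∈ s, c i • f i : Lp ℂ p μ) =ᵐ[μ] fun x => ∑ i ∈ s, c i * f i x := by
  filter_upwards [Lp.coeFn_fun_finsetSum s fun i => c i • f i,
    (Finset.eventually_all s).mpr fun i _ => Lp.coeFn_smul (c i) (f i)] with x hsum hsmul
  rw [hsum]
  exact Finset.sum_congr rfl hsmul

/-- Multiplication by the essentially bounded function `m`, as a bounded operator on `Lᵖ(μ)`. -/
def boundedMul (p : ℝ≥0∞) [Fact (1 ≤ p)] {m : X → ℂ} (hm : MemLp m ∞ μ) :
    Lp ℂ p μ →L[ℂ] Lp ℂ p μ :=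
  (ContinuousLinearMap.mul ℂ ℂ).holderL μ ∞ p p (hm.toLp m)

variable {p : ℝ≥0∞} [Fact (1 ≤ p)] {m : X → ℂ}

theorem coeFn_boundedMul (hm : MemLp m ∞ μ) (f : Lp ℂ p μ) :
    boundedMul p hm f =ᵐ[μ] fun x => m x * f x := by
  filter_upwards [(ContinuousLinearMap.mul ℂ ℂ).coeFn_holder (r := p) (hm.toLp m) f,
    hm.coeFn_toLp] with x hprod hx
  rw [← hx]
  exact hprod

theorem smul_boundedMul (c : ℝ) (hm : MemLp m ∞ μ) :
    c • boundedMul p hm = boundedMul p (hm.const_smul c) := by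
  ext1 f
  refine Lp.ext ?_
  filter_upwards [Lp.coeFn_smul c (boundedMul p hm f), coeFn_boundedMul hm f,
    coeFn_boundedMul (hm.const_smul c) f] with x hsmul hmul hmul'
  rw [hmul']
  simp [hsmul, hmul, mul_assoc]

theorem coeFn_boundedMul_pow (hm : MemLp m ∞ μ) (n : ℕ) (f : Lp ℂ p μ) :
    (boundedMul p hm ^ n) f =ᵐ[μ] fun x => m x ^ n * f x := by
  induction n with
  | zero => simp
  | succ n ih =>
    rw [pow_succ', mul_apply_eq_comp]
    filter_upwards [coeFn_boundedMul hm ((boundedMul p hm ^ n) f), ih] with x hmul hpow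
    rw [hmul, hpow]
    ring

-- The exponential series converges in `Lᵖ`, hence almost everywhere along a subsequence.
theorem coeFn_exp_boundedMul (hm : MemLp m ∞ μ) (f : Lp ℂ p μ) :
    NormedSpace.exp (boundedMul p hm) f =ᵐ[μ] fun x => cexp (m x) * f x := by
  let S : ℕ → Lp ℂ p μ := fun N =>
    ∑ n ∈ Finset.range N, (n.factorial : ℂ)⁻¹ • (boundedMul p hm ^ n) f
  have hS : Filter.Tendsto S Filter.atTop (nhds (NormedSpace.exp (boundedMul p hm) f)) := by
    have h := (NormedSpace.exp_series_hasSum_exp' (𝕂 := ℂ) (boundedMul p hm)).mapL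
      (ContinuousLinearMap.apply ℂ (Lp ℂ p μ) f)
    simpa only [map_smul, ContinuousLinearMap.apply_apply, smul_apply] using h.tendsto_sum_nat
  obtain ⟨N, hN, hlim⟩ := (tendstoInMeasure_of_tendsto_Lp hS).exists_seq_tendsto_ae
  have hsum : ∀ᵐ x ∂μ, ∀ N,
      S N x = ∑ n ∈ Finset.range N, (n.factorial : ℂ)⁻¹ * (m x ^ n * f x) := by
    refine ae_all_iff.mpr fun N => ?_
    filter_upwards [coeFn_sum_smul (Finset.range N) (fun n => (n.factorial : ℂ)⁻¹)
        fun n => (boundedMul p hm ^ n) f, ae_all_iff.mpr fun n => coeFn_boundedMul_pow hm n f]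
      with x hx hpow
    simp only [S, hx, hpow]
  filter_upwards [hlim, hsum] with x hx hSx
  have hexp : HasSum (fun n : ℕ => (n.factorial : ℂ)⁻¹ * (m x ^ n * f x)) (cexp (m x) * f x) := by
    rw [Complex.exp_eq_exp_ℂ]
    simpa [mul_assoc] using (NormedSpace.exp_series_hasSum_exp' (𝕂 := ℂ) (m x)).mul_right (f x)
  refine tendsto_nhds_unique hx ?_
  simp only [hSx]
  exact hexp.tendsto_sum_nat.comp hN.tendsto_atTop

theorem inner_boundedMul_right (hm : MemLp m ∞ μ) (hreal : ∀ x, conj (m x) = m x)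
    (f h : Lp ℂ 2 μ) : ⟪f, boundedMul 2 hm h⟫_ℂ = ⟪boundedMul 2 hm f, h⟫_ℂ := by
  rw [L2.inner_def, L2.inner_def]
  refine integral_congr_ae ?_
  filter_upwards [coeFn_boundedMul hm f, coeFn_boundedMul hm h] with x hf hh
  simp only [hf, hh, RCLike.inner_apply, map_mul, hreal]
  ring

end BoundedMultiplication

section Cutoff

variable {X : Type*} {g : X → ℝ}

/-- The set where `|g| ≤ n`; it corresponds to the spectral subspace of multiplication by `g` for
the interval `[-n, n]`. -/
def cutoffSet (g : X → ℝ) (n : ℕ) : Set X := {x | |g x| ≤ n}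

/-- The function `g`, set to `0` where `|g| > n`. -/
def cutoffFun (g : X → ℝ) (n : ℕ) : X → ℂ := (cutoffSet g n).indicator fun x => (g x : ℂ)

variable [MeasurableSpace X] {μ : Measure X}

theorem ae_of_forall_ae_cutoffSet {q : X → Prop}
    (h : ∀ n, ∀ᵐ x ∂μ, x ∈ cutoffSet g n → q x) : ∀ᵐ x ∂μ, q x := by
  filter_upwards [ae_all_iff.mpr h] with x hx
  obtain ⟨n, hn⟩ := exists_nat_ge |g x|
  exact hx n hn

theorem measurableSet_cutoffSet (hg : Measurable g) (n : ℕ) : MeasurableSet (cutoffSet g n) :=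
  measurableSet_le hg.abs measurable_const

theorem memLp_top_cutoffFun (hg : Measurable g) (n : ℕ) : MemLp (cutoffFun g n) ∞ μ := by
  refine memLp_top_of_bound ((measurable_ofReal.comp hg).indicator
    (measurableSet_cutoffSet hg n)).aestronglyMeasurable n (.of_forall fun x => ?_)
  by_cases hx : x ∈ cutoffSet g n
  · have : |g x| ≤ n := hx
    simpa [cutoffFun, hx]
  · simp [cutoffFun, hx]

theorem memLp_top_indicator_cutoffSet (hg : Measurable g) (n : ℕ) :
    MemLp ((cutoffSet g n).indicator fun _ => (1 : ℂ)) ∞ μ :=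
  (memLp_top_const 1).indicator (measurableSet_cutoffSet hg n)

/-- The spectral projection of multiplication by `g` for the interval `[-n, n]`. -/
def cutoffProj (hg : Measurable g) (n : ℕ) : Lp ℂ 2 μ →L[ℂ] Lp ℂ 2 μ :=
  boundedMul 2 (memLp_top_indicator_cutoffSet hg n)

/-- Multiplication by `g`, compressed to the spectral subspace for the interval `[-n, n]`. -/
def cutoffMul (hg : Measurable g) (n : ℕ) : Lp ℂ 2 μ →L[ℂ] Lp ℂ 2 μ :=
  boundedMul 2 (memLp_top_cutoffFun hg n)

theorem coeFn_cutoffProj (hg : Measurable g) (n : ℕ) (f : Lp ℂ 2 μ) :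
    cutoffProj hg n f =ᵐ[μ] (cutoffSet g n).indicator f := by
  filter_upwards [coeFn_boundedMul (memLp_top_indicator_cutoffSet hg n) f] with x hx
  rw [cutoffProj, hx]
  by_cases h : x ∈ cutoffSet g n <;> simp [h]

theorem coeFn_cutoffMul (hg : Measurable g) (n : ℕ) (f : Lp ℂ 2 μ) :
    cutoffMul hg n f =ᵐ[μ] (cutoffSet g n).indicator fun x => (g x : ℂ) * f x := by
  filter_upwards [coeFn_boundedMul (memLp_top_cutoffFun hg n) f] with x hx
  rw [cutoffMul, hx]
  by_cases h : x ∈ cutoffSet g n <;> simp [cutoffFun, h]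

theorem inner_cutoffProj_right (hg : Measurable g) (n : ℕ) (f h : Lp ℂ 2 μ) :
    ⟪f, cutoffProj hg n h⟫_ℂ = ⟪cutoffProj hg n f, h⟫_ℂ :=
  inner_boundedMul_right _ (fun x => by by_cases hx : x ∈ cutoffSet g n <;> simp [hx]) f h

theorem inner_cutoffMul_right (hg : Measurable g) (n : ℕ) (f h : Lp ℂ 2 μ) :
    ⟪f, cutoffMul hg n h⟫_ℂ = ⟪cutoffMul hg n f, h⟫_ℂ :=
  inner_boundedMul_right _
    (fun x => by by_cases hx : x ∈ cutoffSet g n <;> simp [cutoffFun, hx]) f h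

theorem cutoffMul_eq_cutoffProj_iff (hg : Measurable g) (n : ℕ) (f k : Lp ℂ 2 μ) :
    cutoffMul hg n f = cutoffProj hg n k ↔
      ∀ᵐ x ∂μ, x ∈ cutoffSet g n → k x = (g x : ℂ) * f x := by
  rw [Lp.ext_iff]
  constructor
  · intro h
    filter_upwards [h, coeFn_cutoffMul hg n f, coeFn_cutoffProj hg n k] with x hx hf hk hmem
    rw [hf, hk, Set.indicator_of_mem hmem, Set.indicator_of_mem hmem] at hx
    exact hx.symm
  · intro h
    filter_upwards [h, coeFn_cutoffMul hg n f, coeFn_cutoffProj hg n k] with x hx hf hk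
    rw [hf, hk]
    by_cases hmem : x ∈ cutoffSet g n <;> simp [hmem, hx]

theorem cutoffMul_cutoffProj (hg : Measurable g) (n : ℕ) (f : Lp ℂ 2 μ) :
    cutoffMul hg n (cutoffProj hg n f) = cutoffMul hg n f := by
  refine Lp.ext ?_
  filter_upwards [coeFn_cutoffMul hg n (cutoffProj hg n f), coeFn_cutoffMul hg n f,
    coeFn_cutoffProj hg n f] with x hmulproj hmul hproj
  rw [hmulproj, hmul]
  by_cases hx : x ∈ cutoffSet g n <;> simp [hx, hproj]

end Cutoff

section Spectral

variable {H : Type*} [NormedAddCommGroup H] [InnerProductSpace ℂ H]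
variable {X : Type*} [MeasurableSpace X] {μ : Measure X} {U : H ≃ₗᵢ[ℂ] Lp ℂ 2 μ} {g : X → ℝ}
  {A : H →ₗ.[ℂ] H}

theorem ae_eq_mul_iff_forall_cutoff (hg : Measurable g) (f k : Lp ℂ 2 μ) :
    (k =ᵐ[μ] fun x => (g x : ℂ) * f x) ↔ ∀ n, cutoffMul hg n f = cutoffProj hg n k := by
  simp only [cutoffMul_eq_cutoffProj_iff]
  refine ⟨fun h n => ?_, ae_of_forall_ae_cutoffSet⟩
  filter_upwards [h] with x hx _ using hx

theorem eq_zero_of_forall_cutoffProj_eq_zero (hg : Measurable g) {f : Lp ℂ 2 μ}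
    (hf : ∀ n, cutoffProj hg n f = 0) : f = 0 := by
  have h := (ae_eq_mul_iff_forall_cutoff hg 0 f).mpr fun n => by rw [hf n, map_zero]
  refine Lp.ext ?_
  filter_upwards [h, Lp.coeFn_zero ℂ 2 μ] with x hx hzero
  rw [hx, hzero, Pi.zero_apply, mul_zero]

theorem IsMultiplication.mem_graph_iff (hg : Measurable g) (hA : IsMultiplication U g A)
    {h k : H} : (h, k) ∈ A.graph ↔ ∀ n, cutoffMul hg n (U h) = cutoffProj hg n (U k) :=
  (hA h k).trans (ae_eq_mul_iff_forall_cutoff hg _ _)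

theorem exists_isMultiplication (U : H ≃ₗᵢ[ℂ] Lp ℂ 2 μ) (hg : Measurable g) :
    ∃ A : H →ₗ.[ℂ] H, IsMultiplication U g A := by
  let V : H →ₗ[ℂ] Lp ℂ 2 μ := U.toLinearEquiv.toLinearMap
  let G : Submodule ℂ (H × H) := ⨅ n, LinearMap.eqLocus
    ((cutoffMul hg n).toLinearMap ∘ₗ V ∘ₗ LinearMap.fst ℂ H H)
    ((cutoffProj hg n).toLinearMap ∘ₗ V ∘ₗ LinearMap.snd ℂ H H)
  have hG (h k : H) : (h, k) ∈ G ↔ ∀ n, cutoffMul hg n (U h) = cutoffProj hg n (U k) :=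
    Submodule.mem_iInf _
  refine ⟨G.toLinearPMap, fun h k => ?_⟩
  rw [Submodule.toLinearPMap_graph_eq, hG, ae_eq_mul_iff_forall_cutoff hg]
  rintro ⟨h, k⟩ hmem (rfl : h = 0)
  have hk : U k = 0 := eq_zero_of_forall_cutoffProj_eq_zero hg fun n => by
    rw [← (hG 0 k).mp hmem n, map_zero, map_zero]
  simpa using hk

theorem IsMultiplication.cutoff_mem_graph (hg : Measurable g) (hA : IsMultiplication U g A)
    (n : ℕ) (w : Lp ℂ 2 μ) :
    (U.symm (cutoffProj hg n w), U.symm (cutoffMul hg n w)) ∈ A.graph := by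
  rw [hA, U.apply_symm_apply, U.apply_symm_apply]
  filter_upwards [coeFn_cutoffProj hg n w, coeFn_cutoffMul hg n w] with x hproj hmul
  rw [hproj, hmul]
  by_cases hx : x ∈ cutoffSet g n <;> simp [hx]

theorem IsMultiplication.inner_symm (hA : IsMultiplication U g A) {f f' k k' : H}
    (hf : (f, f') ∈ A.graph) (hk : (k, k') ∈ A.graph) : ⟪f', k⟫_ℂ = ⟪f, k'⟫_ℂ := by
  rw [← U.inner_map_map, ← U.inner_map_map f, L2.inner_def, L2.inner_def]
  refine integral_congr_ae ?_
  filter_upwards [(hA _ _).mp hf, (hA _ _).mp hk] with x hfx hkx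
  simp only [hfx, hkx, RCLike.inner_apply, map_mul, conj_ofReal]
  ring

-- On the subspace `|g| ≤ n` the equation has a bounded generator, so that its solutions are given
-- by the exponential series.
theorem IsMultiplication.ae_eq_exp_of_hasDerivAt (hg : Measurable g)
    (hA : IsMultiplication U g A) {f k : ℝ → H} (hf : ∀ τ, HasDerivAt f (k τ) τ)
    (hk : ∀ τ, (f τ, k τ) ∈ A.graph) (τ : ℝ) :
    (U (f τ) : X → ℂ) =ᵐ[μ] fun x => ((Real.exp (τ * g x) : ℝ) : ℂ) * (U (f 0) : X → ℂ) x := by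
  refine ae_of_forall_ae_cutoffSet (g := g) fun n => ?_
  let u : ℝ → Lp ℂ 2 μ := fun τ => cutoffProj hg n (U (f τ))
  have hu (τ : ℝ) : HasDerivAt u (cutoffMul hg n (u τ)) τ := by
    have hderiv : HasDerivAt u (cutoffProj hg n (U (k τ))) τ :=
      ((cutoffProj hg n ∘L (U.toContinuousLinearEquiv : H →L[ℂ] Lp ℂ 2 μ)).restrictScalars
        ℝ).hasFDerivAt.comp_hasDerivAt τ (hf τ)
    rwa [← (hA.mem_graph_iff hg).mp (hk τ) n, ← cutoffMul_cutoffProj] at hderiv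
  have hm : MemLp (cutoffFun g n) ∞ μ := memLp_top_cutoffFun hg n
  have hsol : u τ = NormedSpace.exp (boundedMul 2 (hm.const_smul τ)) (u 0) := by
    rw [← smul_boundedMul]
    exact eq_exp_smul_apply_of_hasDerivAt hu τ
  have hexp := coeFn_exp_boundedMul (hm.const_smul τ) (u 0)
  rw [← hsol] at hexp
  filter_upwards [hexp, coeFn_cutoffProj hg n (U (f τ)), coeFn_cutoffProj hg n (U (f 0))]
    with x hx hτ h0 hmem
  rw [hτ, h0, Set.indicator_of_mem hmem, Set.indicator_of_mem hmem] at hx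
  simpa [cutoffFun, hmem] using hx

variable [CompleteSpace H]

theorem IsMultiplication.dense (hg : Measurable g) (hA : IsMultiplication U g A) :
    Dense (A.domain : Set H) := by
  rw [Submodule.dense_iff_topologicalClosure_eq_top,
    Submodule.topologicalClosure_eq_top_iff, Submodule.eq_bot_iff]
  intro y hy
  have hproj (n : ℕ) : cutoffProj hg n (U y) = 0 := by
    refine ext_inner_left ℂ fun w => ?_
    have hmem := LinearPMap.mem_domain_of_mem_graph (hA.cutoff_mem_graph hg n w)
    rw [inner_zero_right, inner_cutoffProj_right, ← (Submodule.mem_orthogonal _ _).mp hy _ hmem,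
      ← U.inner_map_map, U.apply_symm_apply]
  simpa using eq_zero_of_forall_cutoffProj_eq_zero hg hproj

theorem IsMultiplication.isSelfAdjoint (hg : Measurable g) (hA : IsMultiplication U g A) :
    IsSelfAdjoint A := by
  rw [LinearPMap.isSelfAdjoint_def]
  refine LinearPMap.eq_of_eq_graph ?_
  rw [LinearPMap.adjoint_graph_eq_graph_adjoint (hA.dense hg)]
  ext ⟨y, z⟩
  rw [Submodule.mem_adjoint_iff]
  refine ⟨fun hadj => (hA.mem_graph_iff hg).mpr fun n => ext_inner_left ℂ fun w => ?_,
    fun hyz a c hac => sub_eq_zero.mpr (hA.inner_symm hac hyz)⟩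
  have h := sub_eq_zero.mp (hadj _ _ (hA.cutoff_mem_graph hg n w))
  rwa [← U.inner_map_map, ← U.inner_map_map (U.symm _), U.apply_symm_apply, U.apply_symm_apply,
    ← inner_cutoffMul_right, ← inner_cutoffProj_right] at h

end Spectral

section SchwartzOperators

open scoped LineDeriv

theorem lineDerivOp_comm {E F : Type*} [NormedAddCommGroup E] [NormedSpace ℝ E]
    [NormedAddCommGroup F] [NormedSpace ℝ F] (m m' : E) (f : 𝓢(E, F)) :
    ∂_{m} (∂_{m'} f) = ∂_{m'} (∂_{m} f) := by
  have hsnd (m m' : E) (v : E) : ∂_{m} (∂_{m'} f) v = fderiv ℝ (fderiv ℝ f) v m m' := by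
    have h := SchwartzMap.iteratedLineDerivOp_eq_iteratedFDeriv (m := ![m, m']) (f := f) (x := v)
    rwa [iteratedFDeriv_two_apply] at h
  ext v
  rw [hsnd, hsnd, ((f.smooth 2).contDiffAt.isSymmSndFDerivAt (by simp)).eq]

theorem hasTemperateGrowth_coord (j : Fin 2) :
    Function.HasTemperateGrowth fun v : Plane => ((v j : ℝ) : ℂ) :=
  (ofRealCLM.comp (EuclideanSpace.proj j : Plane →L[ℝ] ℝ)).hasTemperateGrowth

theorem hasFDerivAt_coord (j : Fin 2) (v : Plane) :
    HasFDerivAt (fun w : Plane => ((w j : ℝ) : ℂ))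
      (ofRealCLM.comp (EuclideanSpace.proj j : Plane →L[ℝ] ℝ)) v :=
  (ofRealCLM.comp (EuclideanSpace.proj j : Plane →L[ℝ] ℝ)).hasFDerivAt

theorem x_apply (j : Fin 2) (f : 𝓢(Plane, ℂ)) (v : Plane) : x j f v = (v j : ℂ) * f v := by
  rw [x, SchwartzMap.smulLeftCLM_apply_apply (hasTemperateGrowth_coord j), smul_eq_mul]

theorem p_apply (j : Fin 2) (f : 𝓢(Plane, ℂ)) (v : Plane) :
    p j f v = -I * fderiv ℝ f v (EuclideanSpace.single j 1) := by
  simp only [p, smul_apply, LineDeriv.lineDerivOpCLM_apply,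
    SchwartzMap.lineDerivOp_apply_eq_fderiv, smul_eq_mul]

theorem x_mul_comm (j k : Fin 2) : x j * x k = x k * x j := by
  ext f v
  simp only [mul_apply_eq_comp, x_apply]
  ring

theorem p_mul_comm (j k : Fin 2) : p j * p k = p k * p j := by
  ext1 f
  simp only [p, smul_mul_smul_comm, smul_apply, mul_apply_eq_comp,
    LineDeriv.lineDerivOpCLM_apply]
  rw [lineDerivOp_comm]

theorem p_mul_x (j k : Fin 2) : p j * x k = x k * p j - (if j = k then I else 0) • 1 := by
  ext f v
  have hprod := ((hasFDerivAt_coord k v).mul (f.hasFDerivAt v)).fderiv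
  have hfderiv : fderiv ℝ (x k f) v = _ :=
    (congrArg (fderiv ℝ · v) (funext (x_apply k f))).trans hprod
  simp only [mul_apply_eq_comp, sub_apply, smul_apply, one_apply_eq_self, x_apply, p_apply,
    hfderiv]
  by_cases hjk : j = k
  · subst hjk
    simp only [add_apply, smul_apply, smul_eq_mul, ContinuousLinearMap.comp_apply,
      PiLp.proj_apply, PiLp.single_eq_same, ofRealCLM_apply, ofReal_one, mul_one, ↓reduceIte]
    ring
  · simp only [add_apply, smul_apply, smul_eq_mul, ContinuousLinearMap.comp_apply, PiLp.proj_apply,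
      PiLp.single_eq_of_ne 2 (Ne.symm hjk), ofRealCLM_apply, ofReal_zero, hjk, ↓reduceIte]
    ring

theorem p_mul_x_self (j : Fin 2) : p j * x j = x j * p j - I • 1 := by simp [p_mul_x]

theorem p_mul_x_of_ne {j k : Fin 2} (h : j ≠ k) : p j * x k = x k * p j := by simp [p_mul_x, h]

theorem coeFn_incl (f : 𝓢(Plane, ℂ)) : incl f =ᵐ[volume] f := SchwartzMap.coeFn_toLp f 2 volume

theorem inner_incl (f g : 𝓢(Plane, ℂ)) :
    ⟪incl f, incl g⟫_ℂ = ∫ v, conj (f v) * g v := by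
  refine (SchwartzMap.inner_toL2_toL2_eq f g).trans ?_
  simp [mul_comm]

theorem incl_mem (f : 𝓢(Plane, ℂ)) : incl f ∈ schwartzD := LinearMap.mem_range_self _ _

theorem dense_schwartzD : Dense (schwartzD : Set Hil) := by
  have h : DenseRange (SchwartzMap.toLpCLM ℂ ℂ 2 (volume : Measure Plane)) :=
    SchwartzMap.denseRange_toLpCLM (by simp)
  simpa [DenseRange, schwartzD, incl] using! h

theorem ev_of_mem_graph {H : Type*} [NormedAddCommGroup H] [InnerProductSpace ℂ H]
    {A : H →ₗ.[ℂ] H} {f g : H} (h : (f, g) ∈ A.graph) : ev A f = g := by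
  have hd : f ∈ A.domain := LinearPMap.mem_domain_of_mem_graph h
  rw [ev, dif_pos hd]
  exact A.mem_graph_snd_inj (A.mem_graph ⟨f, hd⟩) h rfl

/-- The operator `A` on `L²(ℝ²)` is defined on Schwartz functions and acts on them as `S`. -/
def Acts (A : Hil →ₗ.[ℂ] Hil) (S : SOp) : Prop :=
  ∀ f : 𝓢(Plane, ℂ), (incl f, incl (S f)) ∈ A.graph

namespace Acts

variable {A : Hil →ₗ.[ℂ] Hil} {S : SOp}

theorem ev_incl (h : Acts A S) (f : 𝓢(Plane, ℂ)) : ev A (incl f) = incl (S f) :=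
  ev_of_mem_graph (h f)

theorem iterate_ev_incl (h : Acts A S) (n : ℕ) (f : 𝓢(Plane, ℂ)) :
    (ev A)^[n] (incl f) = incl ((S ^ n) f) := by
  induction n with
  | zero => rfl
  | succ n ih => rw [Function.iterate_succ_apply', ih, h.ev_incl, pow_succ', mul_apply_eq_comp]

theorem stable (h : Acts A S) : Stable A schwartzD := by
  refine ⟨?_, ?_⟩
  · rintro _ ⟨f, rfl⟩
    exact LinearPMap.mem_domain_of_mem_graph (h f)
  · rintro _ ⟨f, rfl⟩
    rw [h.ev_incl]
    exact incl_mem _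

end Acts

theorem toPMap_apply_incl (S : SOp) (f : 𝓢(Plane, ℂ)) :
    toPMap S ⟨incl f, incl_mem f⟩ = incl (S f) :=
  congrArg (incl ∘ S) ((LinearEquiv.ofInjective incl incl_injective).symm_apply_apply f)

theorem acts_of_toPMap_le {A : Hil →ₗ.[ℂ] Hil} {S : SOp} (h : toPMap S ≤ A) : Acts A S :=
  fun f => LinearPMap.le_graph_of_le h
    (toPMap_apply_incl S f ▸ (toPMap S).mem_graph ⟨incl f, incl_mem f⟩)

theorem acts_toPMap (S : SOp) : Acts (toPMap S) S := acts_of_toPMap_le le_rfl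

/-- `A'` is a formal adjoint of `A` on Schwartz functions, with respect to the inner product of
`L²(ℝ²)`. -/
def FormalAdj (A A' : SOp) : Prop :=
  ∀ f g : 𝓢(Plane, ℂ), ⟪incl (A f), incl g⟫_ℂ = ⟪incl f, incl (A' g)⟫_ℂ

namespace FormalAdj

variable {A A' B B' : SOp}

theorem symm (h : FormalAdj A A') : FormalAdj A' A := fun f g => by
  rw [← inner_conj_symm, ← h, inner_conj_symm]

theorem add (h : FormalAdj A A') (h' : FormalAdj B B') :
    FormalAdj (A + B) (A' + B') := fun f g => by
  simp only [add_apply, map_add, inner_add_left, inner_add_right, h f g, h' f g]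

theorem sub (h : FormalAdj A A') (h' : FormalAdj B B') :
    FormalAdj (A - B) (A' - B') := fun f g => by
  simp only [sub_apply, map_sub, inner_sub_left, inner_sub_right, h f g, h' f g]

theorem smul (c : ℂ) (h : FormalAdj A A') : FormalAdj (c • A) (conj c • A') := fun f g => by
  simp only [smul_apply, map_smul, inner_smul_left, inner_smul_right, h f g]

theorem isFormalAdjoint_toPMap (h : FormalAdj A A') :
    (toPMap A).IsFormalAdjoint (toPMap A') := by
  rintro ⟨_, f, rfl⟩ ⟨_, g, rfl⟩
  rw [toPMap_apply_incl, toPMap_apply_incl]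
  exact h f g

theorem acts_adjoint (h : FormalAdj A A') : Acts (toPMap A).adjoint A' :=
  acts_of_toPMap_le (h.isFormalAdjoint_toPMap.le_adjoint dense_schwartzD)

theorem acts_adjoint_adjoint (h : FormalAdj A A') : Acts (toPMap A).adjoint.adjoint A :=
  acts_of_toPMap_le <| LinearPMap.IsFormalAdjoint.le_adjoint
    (dense_schwartzD.mono h.acts_adjoint.stable.1)
    (LinearPMap.adjoint_isFormalAdjoint dense_schwartzD)

end FormalAdj

theorem formalAdj_one : FormalAdj 1 1 := fun _ _ => rfl

theorem formalAdj_x (j : Fin 2) : FormalAdj (x j) (x j) := fun f g => by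
  simp only [inner_incl, x_apply, map_mul, conj_ofReal, mul_assoc, mul_left_comm]

theorem formalAdj_p (j : Fin 2) : FormalAdj (p j) (p j) := fun f g => by
  have hparts : ∫ v, conj (f v) * fderiv ℝ g v (EuclideanSpace.single j 1)
      = -∫ v, conj (fderiv ℝ f v (EuclideanSpace.single j 1)) * g v :=
    SchwartzMap.integral_bilinear_lineDerivOp_right_eq_neg_left (μ := volume) f g
      ((ContinuousLinearMap.mul ℝ ℂ).comp (conjCLE : ℂ →L[ℝ] ℂ)) (EuclideanSpace.single j (1 : ℝ))
  simp only [inner_incl, p_apply, map_mul, map_neg, conj_I, neg_neg, mul_left_comm _ (-I),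
    mul_assoc, integral_const_mul, hparts]
  ring

end SchwartzOperators

section Gaussians

theorem norm_iteratedFDeriv_real_eq_norm_iteratedDeriv {f : ℂ → ℂ} {i : ℕ} {z : ℂ}
    (hf : ContDiffAt ℂ i f z) : ‖iteratedFDeriv ℝ i f z‖ = ‖iteratedDeriv i f z‖ := by
  rw [← hf.restrictScalars_iteratedFDeriv (𝕜 := ℝ), Function.comp_apply,
    ← norm_iteratedFDeriv_eq_norm_iteratedDeriv]
  rfl

theorem contDiff_real_cexp {n : WithTop ℕ∞} : ContDiff ℝ n cexp :=
  (contDiff_exp (𝕜 := ℂ)).restrict_scalars ℝ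

theorem norm_iteratedFDeriv_cexp (i : ℕ) (z : ℂ) :
    ‖iteratedFDeriv ℝ i cexp z‖ = ‖cexp z‖ := by
  have h := iteratedDeriv_cexp_const_mul i 1
  simp only [one_mul, one_pow] at h
  rw [norm_iteratedFDeriv_real_eq_norm_iteratedDeriv contDiff_exp.contDiffAt, h]

theorem exists_norm_iteratedFDeriv_cexp_comp_le {E : Type*} [NormedAddCommGroup E]
    [NormedSpace ℝ E] {q : E → ℂ} (hq : Function.HasTemperateGrowth q) (n : ℕ) :
    ∃ (k : ℕ) (C : ℝ), 0 ≤ C ∧ ∀ i ≤ n, ∀ v, ‖iteratedFDeriv ℝ i (fun v => cexp (q v)) v‖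
      ≤ C * (1 + ‖v‖) ^ k * ‖cexp (q v)‖ := by
  obtain ⟨k, C, hC, hbound⟩ := hq.norm_iteratedFDeriv_le_uniform n
  have hone (v : E) : 1 ≤ (1 + C) * (1 + ‖v‖) ^ k :=
    one_le_mul_of_one_le_of_one_le (by simpa using hC) (by simp [one_le_pow₀])
  refine ⟨k * n, n.factorial * (1 + C) ^ n, by positivity, fun i hi v => ?_⟩
  calc ‖iteratedFDeriv ℝ i (fun v => cexp (q v)) v‖
      ≤ i.factorial * ‖cexp (q v)‖ * ((1 + C) * (1 + ‖v‖) ^ k) ^ i := by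
        refine norm_iteratedFDeriv_comp_le contDiff_real_cexp hq.1 (mod_cast le_top) v
          (fun j _ => (norm_iteratedFDeriv_cexp j _).le) fun j hj hji => ?_
        calc ‖iteratedFDeriv ℝ j q v‖ ≤ C * (1 + ‖v‖) ^ k := hbound j (hji.trans hi) v
          _ ≤ (1 + C) * (1 + ‖v‖) ^ k := by gcongr; simp
          _ ≤ ((1 + C) * (1 + ‖v‖) ^ k) ^ j := le_self_pow₀ (hone v) (by lia)
    _ ≤ n.factorial * ‖cexp (q v)‖ * ((1 + C) * (1 + ‖v‖) ^ k) ^ n := by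
        gcongr
        exact hone v
    _ = n.factorial * (1 + C) ^ n * (1 + ‖v‖) ^ (k * n) * ‖cexp (q v)‖ := by
        rw [mul_pow, ← pow_mul]
        ring

theorem hasTemperateGrowth_cexp_mul_I {E : Type*} [NormedAddCommGroup E] [NormedSpace ℝ E]
    {S : E → ℝ} (hS : Function.HasTemperateGrowth S) :
    Function.HasTemperateGrowth fun v => cexp (S v * I) := by
  have hq : Function.HasTemperateGrowth fun v => (S v : ℂ) * I :=
    (Function.Complex.hasTemperateGrowth_ofReal.comp hS).mul (Function.HasTemperateGrowth.const I)
  refine ⟨contDiff_real_cexp.comp hq.1, fun n => ?_⟩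
  obtain ⟨k, C, -, h⟩ := exists_norm_iteratedFDeriv_cexp_comp_le hq n
  refine ⟨k, C, fun v => ?_⟩
  simpa [norm_exp_ofReal_mul_I] using h n le_rfl v

theorem one_add_pow_le_exp {r : ℝ} (hr : 0 ≤ r) (k : ℕ) : (1 + r) ^ k ≤ Real.exp (k * r) := by
  rw [Real.exp_nat_mul, add_comm]
  exact pow_le_pow_left₀ (by positivity) (Real.add_one_le_exp r) k

/-- The linear form `v ↦ β₀ v₀ + β₁ v₁` in the exponent of `gaussFun β`. -/
def linForm (β : Fin 2 → ℂ) : Plane →L[ℝ] ℂ :=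
  β 0 • ofRealCLM.comp (EuclideanSpace.proj 0) + β 1 • ofRealCLM.comp (EuclideanSpace.proj 1)

theorem linForm_apply (β : Fin 2 → ℂ) (v : Plane) :
    linForm β v = β 0 * (v 0 : ℂ) + β 1 * (v 1 : ℂ) := rfl

theorem norm_sq_plane (v : Plane) : ‖v‖ ^ 2 = v 0 ^ 2 + v 1 ^ 2 := by
  simp [EuclideanSpace.norm_sq_eq, Fin.sum_univ_two]

theorem gaussFun_eq_cexp (β : Fin 2 → ℂ) (v : Plane) :
    gaussFun β v = cexp (((-‖v‖ ^ 2 / 2 : ℝ) : ℂ) - linForm β v) := by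
  rw [gaussFun, linForm_apply, neg_div, norm_sq_plane]
  push_cast
  congr 1
  ring

theorem gaussFun_add_smul (γ β : Fin 2 → ℂ) (w : ℂ) (v : Plane) :
    gaussFun (γ + w • β) v = gaussFun γ v * cexp (-w * linForm β v) := by
  rw [gaussFun, gaussFun, linForm_apply, ← Complex.exp_add]
  simp only [Pi.add_apply, Pi.smul_apply, smul_eq_mul]
  congr 1
  ring

theorem norm_gaussFun_le (β : Fin 2 → ℂ) (v : Plane) :
    ‖gaussFun β v‖ ≤ Real.exp (‖linForm β‖ * ‖v‖ - ‖v‖ ^ 2 / 2) := by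
  have hre := (abs_le.mp ((abs_re_le_norm _).trans ((linForm β).le_opNorm v))).1
  rw [gaussFun_eq_cexp, norm_exp, sub_re, ofReal_re, Real.exp_le_exp]
  linarith

theorem hasTemperateGrowth_gaussExponent (β : Fin 2 → ℂ) : Function.HasTemperateGrowth
    fun v : Plane =>
      -(1 / 2) * ((v 0 : ℂ) ^ 2 + (v 1 : ℂ) ^ 2) - β 0 * (v 0 : ℂ) - β 1 * (v 1 : ℂ) := by
  have h := hasTemperateGrowth_coord
  exact (((Function.HasTemperateGrowth.const _).mul (((h 0).pow 2).add ((h 1).pow 2))).sub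
    ((Function.HasTemperateGrowth.const _).mul (h 0))).sub
    ((Function.HasTemperateGrowth.const _).mul (h 1))

theorem contDiff_gaussFun (β : Fin 2 → ℂ) {n : ℕ∞} : ContDiff ℝ n (gaussFun β) :=
  (contDiff_real_cexp.comp (hasTemperateGrowth_gaussExponent β).1).of_le (mod_cast le_top)

theorem exists_norm_iteratedFDeriv_gaussFun_le (β : Fin 2 → ℂ) (n : ℕ) :
    ∃ C c : ℝ, 0 ≤ C ∧ ∀ i ≤ n, ∀ v,
      ‖iteratedFDeriv ℝ i (gaussFun β) v‖ ≤ C * Real.exp (c * ‖v‖ - ‖v‖ ^ 2 / 2) := by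
  obtain ⟨m, C, hC, h⟩ :=
    exists_norm_iteratedFDeriv_cexp_comp_le (hasTemperateGrowth_gaussExponent β) n
  refine ⟨C, m + ‖linForm β‖, hC, fun i hi v => ?_⟩
  calc ‖iteratedFDeriv ℝ i (gaussFun β) v‖ ≤ C * (1 + ‖v‖) ^ m * ‖gaussFun β v‖ := h i hi v
    _ ≤ C * Real.exp (m * ‖v‖) * Real.exp (‖linForm β‖ * ‖v‖ - ‖v‖ ^ 2 / 2) := by
        gcongr
        · exact one_add_pow_le_exp (norm_nonneg v) m
        · exact norm_gaussFun_le β v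
    _ = C * Real.exp ((m + ‖linForm β‖) * ‖v‖ - ‖v‖ ^ 2 / 2) := by
        rw [mul_assoc, ← Real.exp_add]
        ring_nf

theorem exists_decay_gaussFun_mul (β : Fin 2 → ℂ) (k n : ℕ) (c : ℝ) :
    ∃ C : ℝ, 0 ≤ C ∧ ∀ (φ : Plane → ℂ) (M : ℝ), ContDiff ℝ n φ →
      (∀ i ≤ n, ∀ v, ‖iteratedFDeriv ℝ i φ v‖ ≤ M * Real.exp (c * ‖v‖)) →
      ∀ v, ‖v‖ ^ k * ‖iteratedFDeriv ℝ n (fun v => gaussFun β v * φ v) v‖ ≤ C * M := by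
  obtain ⟨C, m, hC, hgauss⟩ := exists_norm_iteratedFDeriv_gaussFun_le β n
  refine ⟨2 ^ n * C * Real.exp ((k + m + c) ^ 2 / 2), by positivity, fun φ M hφ hM v => ?_⟩
  set r := ‖v‖
  have hr : 0 ≤ r := norm_nonneg v
  have hM0 : 0 ≤ M :=
    nonneg_of_mul_nonneg_left ((norm_nonneg _).trans (hM 0 n.zero_le v)) (Real.exp_pos _)
  have hpow : r ^ k ≤ Real.exp (k * r) :=
    (pow_le_pow_left₀ hr (by linarith) k).trans (one_add_pow_le_exp hr k)
  have hleibniz : ‖iteratedFDeriv ℝ n (fun v => gaussFun β v * φ v) v‖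
      ≤ 2 ^ n * ((C * Real.exp (m * r - r ^ 2 / 2)) * (M * Real.exp (c * r))) := by
    refine (norm_iteratedFDeriv_mul_le (contDiff_gaussFun β) hφ v le_rfl).trans ?_
    calc ∑ i ∈ Finset.range (n + 1), (n.choose i : ℝ) * ‖iteratedFDeriv ℝ i (gaussFun β) v‖
          * ‖iteratedFDeriv ℝ (n - i) φ v‖
        ≤ ∑ i ∈ Finset.range (n + 1), (n.choose i : ℝ)
          * (C * Real.exp (m * r - r ^ 2 / 2)) * (M * Real.exp (c * r)) := by
          gcongr with i hi
          · exact hgauss i (by simpa [Nat.lt_succ_iff] using hi) v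
          · exact hM (n - i) (n.sub_le i) v
      _ = _ := by
          simp only [mul_assoc, ← Finset.sum_mul]
          norm_cast
          rw [Nat.sum_range_choose]
  calc r ^ k * ‖iteratedFDeriv ℝ n (fun v => gaussFun β v * φ v) v‖
      ≤ Real.exp (k * r)
        * (2 ^ n * ((C * Real.exp (m * r - r ^ 2 / 2)) * (M * Real.exp (c * r)))) := by gcongr
    _ = 2 ^ n * C * Real.exp (k * r + (m * r - r ^ 2 / 2) + c * r) * M := by
        rw [Real.exp_add, Real.exp_add]
        ring
    _ ≤ 2 ^ n * C * Real.exp ((k + m + c) ^ 2 / 2) * M := by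
        gcongr
        linarith [sq_nonneg (k + m + c - r)]

/-- The Gaussian `gaussFun β` as a Schwartz function. -/
def gS (β : Fin 2 → ℂ) : 𝓢(Plane, ℂ) where
  toFun := gaussFun β
  smooth' := contDiff_gaussFun β
  decay' k n := by
    obtain ⟨C, -, hC⟩ := exists_decay_gaussFun_mul β k n 0
    refine ⟨C, fun v => ?_⟩
    have hone (i : ℕ) (w : Plane) : ‖iteratedFDeriv ℝ i (fun _ : Plane => (1 : ℂ)) w‖ ≤ 1 := by
      rcases i with _ | i
      · simp
      · simp [iteratedFDeriv_const_of_ne]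
    simpa using hC (fun _ => 1) 1 contDiff_const (fun i _ w => by simpa using hone i w) v

theorem gS_apply (β : Fin 2 → ℂ) (v : Plane) : gS β v = gaussFun β v := rfl

theorem incl_gS (β : Fin 2 → ℂ) : incl (gS β) = gauss β := by
  refine Lp.ext ?_
  filter_upwards [coeFn_incl (gS β), (memLp_gaussFun β).coeFn_toLp] with v h1 h2
  rw [h1, gauss, h2, gS_apply]

theorem p_gS (j : Fin 2) (β : Fin 2 → ℂ) : p j (gS β) = I • (x j (gS β) + β j • gS β) := by
  ext v
  have hgauss := ((((((hasFDerivAt_coord 0 v).pow 2).add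
    ((hasFDerivAt_coord 1 v).pow 2)).const_mul (-(1 / 2))).sub
    ((hasFDerivAt_coord 0 v).const_mul (β 0))).sub
    ((hasFDerivAt_coord 1 v).const_mul (β 1))).cexp
  have hfderiv : fderiv ℝ (gS β) v = _ := HasFDerivAt.fderiv (f := gS β) hgauss
  rw [p_apply, hfderiv]
  simp only [smul_apply, add_apply, sub_apply, x_apply, gS_apply, gaussFun, Pi.add_apply,
    Pi.sub_apply, nsmul_eq_mul, smul_eq_mul, ContinuousLinearMap.comp_apply, PiLp.proj_apply,
    ofRealCLM_apply]
  fin_cases j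
  · simp only [Fin.zero_eta, PiLp.single_eq_same, ofReal_one,
      PiLp.single_eq_of_ne 2 (zero_ne_one' (Fin 2)).symm, ofReal_zero]
    ring
  · simp only [Fin.mk_one, PiLp.single_eq_same, ofReal_one,
      PiLp.single_eq_of_ne 2 (zero_ne_one' (Fin 2)), ofReal_zero]
    ring

/-- Multiplication by the linear form `linForm β`, as an operator on `𝓢(ℝ²)`. -/
def linS (β : Fin 2 → ℂ) : SOp := β 0 • x 0 + β 1 • x 1

theorem linS_apply (β : Fin 2 → ℂ) (f : 𝓢(Plane, ℂ)) (v : Plane) :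
    linS β f v = linForm β v * f v := by
  simp only [linS, add_apply, smul_apply, x_apply, smul_eq_mul, linForm_apply]
  ring

/-- The remainder `exp (c z) - 1 - c z` of the exponential series at order two. -/
def expRemainder (c z : ℂ) : ℂ := cexp (c * z) - 1 - c * z

theorem contDiff_expRemainder (c : ℂ) {n : WithTop ℕ∞} : ContDiff ℂ n (expRemainder c) := by
  unfold expRemainder
  fun_prop

theorem deriv_expRemainder (c : ℂ) :
    deriv (expRemainder c) = fun z => c * (cexp (c * z) - 1) := by
  funext z
  have hmul : HasDerivAt (fun z => c * z) c z := by simpa using (hasDerivAt_id z).const_mul c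
  have h := ((hmul.cexp.sub_const 1).sub hmul).deriv
  exact h.trans (by ring)

theorem deriv_deriv_expRemainder (c : ℂ) :
    deriv (deriv (expRemainder c)) = fun z => c ^ 2 * cexp (c * z) := by
  rw [deriv_expRemainder]
  funext z
  have hmul : HasDerivAt (fun z => c * z) c z := by simpa using (hasDerivAt_id z).const_mul c
  have h := ((hmul.cexp.sub_const 1).const_mul c).deriv
  exact h.trans (by ring)

theorem norm_pow_mul_exp_norm_mul_le {c : ℂ} (hc : ‖c‖ ≤ 1) (z : ℂ) {k : ℕ} (hk : k ≤ 2) :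
    ‖z‖ ^ k * Real.exp ‖c * z‖ ≤ Real.exp (3 * ‖z‖) := by
  have hpow : ‖z‖ ^ k ≤ Real.exp (k * ‖z‖) :=
    (pow_le_pow_left₀ (norm_nonneg z) (by linarith) k).trans (one_add_pow_le_exp (norm_nonneg z) k)
  have hk' : (k : ℝ) ≤ 2 := mod_cast hk
  calc ‖z‖ ^ k * Real.exp ‖c * z‖ ≤ Real.exp (k * ‖z‖) * Real.exp ‖z‖ := by
        gcongr
        rw [norm_mul]
        exact mul_le_of_le_one_left (norm_nonneg z) hc
    _ = Real.exp ((k + 1) * ‖z‖) := by rw [← Real.exp_add]; ring_nf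
    _ ≤ Real.exp (3 * ‖z‖) := by
        gcongr
        linarith

theorem norm_iteratedDeriv_expRemainder_le {c : ℂ} (hc : ‖c‖ ≤ 1) (i : ℕ) (z : ℂ) :
    ‖iteratedDeriv i (expRemainder c) z‖ ≤ ‖c‖ ^ 2 * Real.exp (3 * ‖z‖) := by
  have hterm (k : ℕ) (hk : k ≤ 2) :
      ‖c‖ ^ k * (‖z‖ ^ k * Real.exp ‖c * z‖) ≤ ‖c‖ ^ k * Real.exp (3 * ‖z‖) :=
    mul_le_mul_of_nonneg_left (norm_pow_mul_exp_norm_mul_le hc z hk) (by positivity)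
  rcases i with _ | _ | i
  · rw [iteratedDeriv_zero]
    refine le_trans ?_ (hterm 2 le_rfl)
    have h := norm_exp_sub_sum_le_norm_mul_exp (c * z) 2
    rw [norm_mul c z, mul_pow, ← norm_mul] at h
    simpa [Finset.sum_range_succ, expRemainder, sub_sub, mul_assoc] using h
  · rw [zero_add, iteratedDeriv_one, deriv_expRemainder, norm_mul, pow_two, mul_assoc]
    gcongr
    refine le_trans ?_ (by simpa using hterm 1 one_le_two)
    have h := norm_exp_sub_sum_le_norm_mul_exp (c * z) 1
    rw [pow_one, norm_mul c z, ← norm_mul] at h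
    simpa [mul_assoc] using h
  · rw [iteratedDeriv_succ', iteratedDeriv_succ', deriv_deriv_expRemainder,
      iteratedDeriv_const_mul_field, iteratedDeriv_cexp_const_mul, norm_mul, norm_pow, norm_mul,
      norm_pow]
    gcongr
    calc ‖c‖ ^ i * ‖cexp (c * z)‖ ≤ 1 * Real.exp ‖c * z‖ := by
          gcongr
          · exact pow_le_one₀ (norm_nonneg c) hc
          · exact norm_exp_le_exp_norm _
      _ ≤ Real.exp (3 * ‖z‖) := by
          simpa using norm_pow_mul_exp_norm_mul_le hc z zero_le_two

theorem norm_iteratedFDeriv_expRemainder_comp_le {E : Type*} [NormedAddCommGroup E]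
    [NormedSpace ℝ E] (ℓ : E →L[ℝ] ℂ) {c : ℂ} (hc : ‖c‖ ≤ 1) {i n : ℕ} (hi : i ≤ n) (v : E) :
    ‖iteratedFDeriv ℝ i (fun v => expRemainder c (ℓ v)) v‖
      ≤ (1 + ‖ℓ‖) ^ n * ‖c‖ ^ 2 * Real.exp (3 * ‖ℓ‖ * ‖v‖) := by
  have hsmooth := (contDiff_expRemainder c (n := i)).restrict_scalars ℝ
  have hrem := norm_iteratedDeriv_expRemainder_le hc i (ℓ v)
  rw [← norm_iteratedFDeriv_real_eq_norm_iteratedDeriv (contDiff_expRemainder c).contDiffAt] at hrem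
  calc ‖iteratedFDeriv ℝ i (expRemainder c ∘ ℓ) v‖
      ≤ ‖iteratedFDeriv ℝ i (expRemainder c) (ℓ v)‖ * ‖ℓ‖ ^ i := by
        rw [ℓ.iteratedFDeriv_comp_right hsmooth v le_rfl]
        simpa using ContinuousMultilinearMap.norm_compContinuousLinearMap_le
          (iteratedFDeriv ℝ i (expRemainder c) (ℓ v)) fun _ => ℓ
    _ ≤ (‖c‖ ^ 2 * Real.exp (3 * (‖ℓ‖ * ‖v‖))) * (1 + ‖ℓ‖) ^ n := by
        gcongr ?_ * ?_
        · exact hrem.trans (by gcongr; exact ℓ.le_opNorm v)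
        · exact (pow_le_pow_left₀ (norm_nonneg _) (by linarith) i).trans
            (pow_le_pow_right₀ (by linarith [norm_nonneg ℓ]) hi)
    _ = (1 + ‖ℓ‖) ^ n * ‖c‖ ^ 2 * Real.exp (3 * ‖ℓ‖ * ‖v‖) := by
        rw [mul_assoc 3]
        ring

theorem exists_seminorm_gS_add_smul_le (γ β : Fin 2 → ℂ) (k n : ℕ) :
    ∃ C : ℝ, ∀ w : ℂ, ‖w‖ ≤ 1 →
      SchwartzMap.seminorm ℂ k n (gS (γ + w • β) - gS γ + w • linS β (gS γ)) ≤ C * ‖w‖ ^ 2 := by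
  obtain ⟨C, hC0, hC⟩ := exists_decay_gaussFun_mul γ k n (3 * ‖linForm β‖)
  refine ⟨C * (1 + ‖linForm β‖) ^ n, fun w hw => ?_⟩
  have heq : (gS (γ + w • β) - gS γ + w • linS β (gS γ) : 𝓢(Plane, ℂ))
      = fun v => gaussFun γ v * expRemainder (-w) (linForm β v) := by
    funext v
    simp only [add_apply, sub_apply, smul_apply, linS_apply, gS_apply, gaussFun_add_smul,
      expRemainder, smul_eq_mul]
    ring
  have hrem (i : ℕ) (hi : i ≤ n) (v : Plane) :
      ‖iteratedFDeriv ℝ i (fun v => expRemainder (-w) (linForm β v)) v‖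
        ≤ (1 + ‖linForm β‖) ^ n * ‖w‖ ^ 2 * Real.exp (3 * ‖linForm β‖ * ‖v‖) := by
    simpa only [norm_neg] using
      norm_iteratedFDeriv_expRemainder_comp_le (linForm β) (c := -w) (by simpa) hi v
  refine SchwartzMap.seminorm_le_bound ℂ k n _ (by positivity) fun v => ?_
  rw [heq, mul_assoc]
  exact hC _ _ (((contDiff_expRemainder (-w)).restrict_scalars ℝ).comp (linForm β).contDiff) hrem v

theorem exists_norm_le_sum_seminorm {E F : Type*} [NormedAddCommGroup E] [NormedSpace ℝ E]
    [NormedAddCommGroup F] [NormedSpace ℂ F] (L : 𝓢(E, ℂ) →L[ℂ] F) :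
    ∃ (s : Finset (ℕ × ℕ)) (C : ℝ), 0 ≤ C ∧
      ∀ f, ‖L f‖ ≤ C * ∑ i ∈ s, SchwartzMap.seminorm ℂ i.1 i.2 f := by
  obtain ⟨s, C, -, hC⟩ := Seminorm.bound_of_continuous (schwartz_withSeminorms ℂ E ℂ)
    ((normSeminorm ℂ F).comp L.toLinearMap) (continuous_norm.comp L.continuous)
  refine ⟨s, C, C.coe_nonneg, fun f => (hC f).trans ?_⟩
  have hsum := Seminorm.finset_sup_le_sum (schwartzSeminormFamily ℂ E ℂ) s f
  rw [sum_apply] at hsum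
  exact mul_le_mul_of_nonneg_left hsum C.coe_nonneg

theorem hasDerivAt_gS {F : Type*} [NormedAddCommGroup F] [NormedSpace ℂ F]
    (L : 𝓢(Plane, ℂ) →L[ℂ] F) (γ β : Fin 2 → ℂ) (w : ℂ) :
    HasDerivAt (fun w : ℂ => L (gS (γ + w • β))) (-L (linS β (gS (γ + w • β)))) w := by
  obtain ⟨s, C, hC, hL⟩ := exists_norm_le_sum_seminorm L
  choose D hD using fun i : ℕ × ℕ => exists_seminorm_gS_add_smul_le (γ + w • β) β i.1 i.2
  have hquad : (fun h : ℂ => L (gS (γ + w • β + h • β) - gS (γ + w • β)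
      + h • linS β (gS (γ + w • β)))) =O[nhds 0] fun h : ℂ => h ^ 2 := by
    refine Asymptotics.IsBigO.of_bound (C * ∑ i ∈ s, D i) ?_
    filter_upwards [Metric.closedBall_mem_nhds (0 : ℂ) one_pos] with h hh
    rw [norm_pow, mul_assoc, Finset.sum_mul]
    refine (hL _).trans ?_
    gcongr with i
    exact hD i h (by simpa using hh)
  rw [hasDerivAt_iff_isLittleO_nhds_zero]
  refine (hquad.trans_isLittleO (Asymptotics.isLittleO_pow_id one_lt_two)).congr_left fun h => ?_
  rw [map_add, map_sub, map_smul, smul_neg, sub_neg_eq_add, add_smul, add_assoc]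

end Gaussians

section QuadraticTerms

theorem eqModQuadratic_monomial {i : ℕ × ℕ} (hi : 2 ≤ i.1 + i.2) (r : SOp) :
    EqModQuadratic (fun s t => ((s ^ i.1 * t ^ i.2 : ℝ) : ℂ) • r) 0 := by
  refine ⟨Finsupp.single i r, fun j hj => ?_, fun s t => ?_⟩
  · obtain rfl := Finset.mem_singleton.mp (Finsupp.support_single_subset hj)
    exact hi
  · rw [Finsupp.sum_single_index (by simp)]
    simp

theorem eqModQuadratic_of_eq {F G : ℝ → ℝ → SOp} (h : ∀ s t, F s t = G s t) :
    EqModQuadratic F G :=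
  ⟨0, by simp, fun s t => by simp [h s t]⟩

theorem EqModQuadratic.add {F G F' G' : ℝ → ℝ → SOp} (h : EqModQuadratic F G)
    (h' : EqModQuadratic F' G') : EqModQuadratic (F + F') (G + G') := by
  classical
  obtain ⟨R, hR, e⟩ := h
  obtain ⟨R', hR', e'⟩ := h'
  refine ⟨R + R', fun j hj => ?_, fun s t => ?_⟩
  · rcases Finset.mem_union.mp (Finsupp.support_add hj) with h | h
    exacts [hR j h, hR' j h]
  · rw [Finsupp.sum_add_index' (by simp) (by simp [smul_add]), ← e, ← e']
    simp only [Pi.add_apply]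
    abel

theorem eqModQuadratic_of_terms {F G : ℝ → ℝ → SOp} (r₁ r₂ r₃ : SOp)
    (h : ∀ s t : ℝ, F s t - G s t = ((s ^ 2 : ℝ) : ℂ) • r₁ + ((s * t : ℝ) : ℂ) • r₂
      + ((t ^ 2 : ℝ) : ℂ) • r₃) : EqModQuadratic F G := by
  obtain ⟨R, hR, e⟩ := ((eqModQuadratic_monomial (i := (2, 0)) (by norm_num) r₁).add
    (eqModQuadratic_monomial (i := (1, 1)) (by norm_num) r₂)).add
    (eqModQuadratic_monomial (i := (0, 2)) (by norm_num) r₃)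
  refine ⟨R, hR, fun s t => ?_⟩
  rw [h, ← e]
  simp

theorem eqModQuadratic_comm_xHat_pHat (j k : Fin 2) : EqModQuadratic
    (fun s t => xHat s j * pHat t k - pHat t k * xHat s j)
    (fun _ _ => if j = k then I • 1 else 0) := by
  refine eqModQuadratic_of_terms 0 (if j = k then (I / 4) • 1 else 0) 0 fun s t => ?_
  fin_cases j <;> fin_cases k <;>
  · simp only [Fin.zero_eta, Fin.mk_one, xHat, pHat, Matrix.cons_val_zero, Matrix.cons_val_one,
      mul_add, add_mul, mul_sub, sub_mul, smul_mul_assoc, mul_smul_comm, p_mul_x_self,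
      p_mul_x_of_ne (zero_ne_one : (0 : Fin 2) ≠ 1), p_mul_x_of_ne (one_ne_zero : (1 : Fin 2) ≠ 0),
      x_mul_comm 1 0, p_mul_comm 1 0, if_true, zero_ne_one, one_ne_zero, if_false]
    match_scalars <;> ring

theorem comm_xHat (s : ℝ) (j k : Fin 2) :
    xHat s j * xHat s k - xHat s k * xHat s j = (I * (s : ℂ) * eps j k) • 1 := by
  fin_cases j <;> fin_cases k <;>
  · simp only [Fin.zero_eta, Fin.mk_one, xHat, eps, Matrix.cons_val_zero, Matrix.cons_val_one,
      mul_add, add_mul, mul_sub, sub_mul, smul_mul_assoc, mul_smul_comm, p_mul_x_self,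
      p_mul_x_of_ne (zero_ne_one : (0 : Fin 2) ≠ 1), p_mul_x_of_ne (one_ne_zero : (1 : Fin 2) ≠ 0),
      x_mul_comm 1 0, p_mul_comm 1 0]
    match_scalars <;> simp <;> ring

theorem comm_pHat (t : ℝ) (j k : Fin 2) :
    pHat t j * pHat t k - pHat t k * pHat t j = (I * (t : ℂ) * eps j k) • 1 := by
  fin_cases j <;> fin_cases k <;>
  · simp only [Fin.zero_eta, Fin.mk_one, pHat, eps, Matrix.cons_val_zero, Matrix.cons_val_one,
      mul_add, add_mul, mul_sub, sub_mul, smul_mul_assoc, mul_smul_comm, p_mul_x_self,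
      p_mul_x_of_ne (zero_ne_one : (0 : Fin 2) ≠ 1), p_mul_x_of_ne (one_ne_zero : (1 : Fin 2) ≠ 0),
      x_mul_comm 1 0, p_mul_comm 1 0]
    match_scalars <;> simp <;> ring

theorem eqModQuadratic_hHat_hTrunc (A B : ℝ) : EqModQuadratic (hHat A B) (hTrunc A B) := by
  refine eqModQuadratic_of_terms ((1 / 8 : ℂ) • (p 0 * p 0 + p 1 * p 1)) 0
    ((1 / 8 : ℂ) • (x 0 * x 0 + x 1 * x 1)) fun s t => ?_
  simp only [hHat, hTrunc, xHat, pHat, Matrix.cons_val_zero, Matrix.cons_val_one, pow_two, mul_add,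
    add_mul, mul_sub, sub_mul, smul_mul_assoc, mul_smul_comm,
    p_mul_x_of_ne (zero_ne_one : (0 : Fin 2) ≠ 1), p_mul_x_of_ne (one_ne_zero : (1 : Fin 2) ≠ 0)]
  match_scalars <;> simp <;> ring

theorem eqModQuadratic_hHat_hNumber (A B : ℝ) : EqModQuadratic (hHat A B) (hNumber A B) := by
  refine eqModQuadratic_of_terms
    ((1 / 8 : ℂ) • (p 0 * p 0 + p 1 * p 1) - (B ^ 2 / 4 : ℂ) • 1 + (I * B / 4) • (p 0 + p 1))
    (-((A ^ 2 + B ^ 2) / 2 : ℂ) • 1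
      + (I / 4) • ((A : ℂ) • (x 0 + x 1) + (B : ℂ) • (p 0 + p 1)))
    ((1 / 8 : ℂ) • (x 0 * x 0 + x 1 * x 1) - (A ^ 2 / 4 : ℂ) • 1 + (I * A / 4) • (x 0 + x 1))
    fun s t => ?_
  simp only [hHat, hNumber, N, aS, bS, X, P, xHat, pHat, Matrix.cons_val_zero, Matrix.cons_val_one,
    pow_two, mul_add, add_mul, mul_sub, sub_mul, smul_add, smul_sub, smul_neg, mul_neg,
    smul_mul_assoc, mul_smul_comm, mul_one, one_mul, p_mul_x_self,
    p_mul_x_of_ne (zero_ne_one : (0 : Fin 2) ≠ 1), p_mul_x_of_ne (one_ne_zero : (1 : Fin 2) ≠ 0),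
    x_mul_comm 1 0, p_mul_comm 1 0]
  match_scalars <;> ring_nf <;> simp only [I_sq, I_pow_three, I_pow_four] <;> ring

end QuadraticTerms

section PseudoBosons

theorem comm_add_smul_one (S T : SOp) (c d : ℂ) :
    (S + c • 1) * (T + d • 1) - (T + d • 1) * (S + c • 1) = S * T - T * S := by
  simp only [mul_add, add_mul, smul_mul_assoc, mul_smul_comm, one_mul, mul_one]
  module

theorem Acts.comm_ev_incl {A A' : Hil →ₗ.[ℂ] Hil} {S S' : SOp} (h : Acts A S) (h' : Acts A' S')
    (f : 𝓢(Plane, ℂ)) :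
    ev A (ev A' (incl f)) - ev A' (ev A (incl f)) = incl ((S * S' - S' * S) f) := by
  rw [h'.ev_incl, h.ev_incl, h.ev_incl, h'.ev_incl, ← map_sub, sub_apply, mul_apply_eq_comp,
    mul_apply_eq_comp]

theorem isPseudoBosonic_of_acts {a b : Fin 2 → Hil →ₗ.[ℂ] Hil} {sa sb sa' sb' : Fin 2 → SOp}
    (ha : ∀ j, Acts (a j) (sa j)) (hb : ∀ j, Acts (b j) (sb j))
    (ha' : ∀ j, Acts (a j).adjoint (sa' j)) (hb' : ∀ j, Acts (b j).adjoint (sb' j))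
    (hab : ∀ j k, sa j * sb k - sb k * sa j = if j = k then 1 else 0)
    (haa : ∀ j k, sa j * sa k - sa k * sa j = 0) (hbb : ∀ j k, sb j * sb k - sb k * sb j = 0) :
    IsPseudoBosonic schwartzD a b where
  dense := dense_schwartzD
  stable_a j := (ha j).stable
  stable_b j := (hb j).stable
  stable_a_adjoint j := (ha' j).stable
  stable_b_adjoint j := (hb' j).stable
  comm_ab j k := by
    rintro _ ⟨f, rfl⟩
    rw [(ha j).comm_ev_incl (hb k), hab]
    split_ifs <;> simp
  comm_aa j k := by
    rintro _ ⟨f, rfl⟩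
    rw [(ha j).comm_ev_incl (ha k), haa, zero_apply, map_zero]
  comm_bb j k := by
    rintro _ ⟨f, rfl⟩
    rw [(hb j).comm_ev_incl (hb k), hbb, zero_apply, map_zero]

/-- The normalization constant `(n₁! n₂!)^{-1/2}` of `ladder`. -/
def ladderConst (n : ℕ × ℕ) : ℂ := (((Real.sqrt (n.1.factorial * n.2.factorial))⁻¹ : ℝ) : ℂ)

theorem ladder_incl {A : Fin 2 → Hil →ₗ.[ℂ] Hil} {S : Fin 2 → SOp} (h : ∀ j, Acts (A j) (S j))
    (f : 𝓢(Plane, ℂ)) (n : ℕ × ℕ) :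
    ladder A (incl f) n = ladderConst n • incl ((S 0 ^ n.1) ((S 1 ^ n.2) f)) := by
  rw [ladder, (h 1).iterate_ev_incl, (h 0).iterate_ev_incl, ladderConst]

theorem ladder_smul_incl {A : Fin 2 → Hil →ₗ.[ℂ] Hil} {S : Fin 2 → SOp}
    (h : ∀ j, Acts (A j) (S j)) (c : ℂ) (f : 𝓢(Plane, ℂ)) (n : ℕ × ℕ) :
    ladder A (c • incl f) n = c • ladder A (incl f) n := by
  rw [← map_smul, ladder_incl h, ladder_incl h, map_smul, map_smul, map_smul, smul_comm]

theorem ladder_incl_mem {A : Fin 2 → Hil →ₗ.[ℂ] Hil} {S : Fin 2 → SOp}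
    (h : ∀ j, Acts (A j) (S j)) (f : 𝓢(Plane, ℂ)) (n : ℕ × ℕ) :
    ladder A (incl f) n ∈ schwartzD := by
  rw [ladder_incl h]
  exact Submodule.smul_mem _ _ (incl_mem _)

/-- The annihilation operators `c_g`, `c_d`, on `𝓢(ℝ²)`. -/
def annS : Fin 2 → SOp :=
  ![(1 / 2 : ℂ) • (x 0 + I • p 0 + I • x 1 - p 1), (1 / 2 : ℂ) • (-(I • x 0) + p 0 - x 1 - I • p 1)]

/-- The creation operators `c_g†`, `c_d†`, on `𝓢(ℝ²)`. -/
def creS : Fin 2 → SOp :=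
  ![(1 / 2 : ℂ) • (x 0 - I • p 0 - I • x 1 - p 1), (1 / 2 : ℂ) • (I • x 0 + p 0 - x 1 + I • p 1)]

theorem one_div_sqrt_two_mul_self :
    ((1 / Real.sqrt 2 : ℝ) : ℂ) * ((1 / Real.sqrt 2 : ℝ) : ℂ) = 1 / 2 := by
  rw [← ofReal_mul, div_mul_div_comm, Real.mul_self_sqrt (by norm_num)]
  norm_num

theorem cgd_eq (j : Fin 2) : cgd j = toPMap (annS j) := by
  have hsqrt := one_div_sqrt_two_mul_self
  simp only [cgd, annS, cS]
  set r : ℂ := ((1 / Real.sqrt 2 : ℝ) : ℂ)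
  have hg : r • (r • (x 0 + I • p 0) + I • r • (x 1 + I • p 1))
      = (1 / 2 : ℂ) • (x 0 + I • p 0 + I • x 1 - p 1) := by
    rw [smul_comm I r, ← smul_add, smul_smul, hsqrt]
    match_scalars <;> simp
  have hd : (-I * r) • (r • (x 0 + I • p 0) - I • r • (x 1 + I • p 1))
      = (1 / 2 : ℂ) • (-(I • x 0) + p 0 - x 1 - I • p 1) := by
    rw [smul_comm I r, ← smul_sub, smul_smul, mul_assoc, hsqrt]
    match_scalars <;> ring_nf <;> norm_num [I_pow_three]
  fin_cases j
  · exact congrArg toPMap hg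
  · exact congrArg toPMap hd

theorem formalAdj_annS (j : Fin 2) : FormalAdj (annS j) (creS j) := by
  have hx := formalAdj_x
  have hp := formalAdj_p
  fin_cases j
  · convert ((((hx 0).add ((hp 0).smul I)).add ((hx 1).smul I)).sub (hp 1)).smul (1 / 2) using 1
    · rfl
    · simp only [creS, Fin.zero_eta, Matrix.cons_val_zero, conj_I, map_div₀, map_one, map_ofNat]
      module
  · convert (((((hx 0).smul (-I)).add (hp 0)).sub (hx 1)).sub ((hp 1).smul I)).smul (1 / 2)
      using 1
    · simp only [annS, Fin.mk_one, Matrix.cons_val_one, Matrix.cons_val_fin_one]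
      module
    · simp only [creS, Fin.mk_one, Matrix.cons_val_one, Matrix.cons_val_fin_one, conj_I, map_neg,
        map_div₀, map_one, map_ofNat]
      module

theorem comm_annS_creS (j k : Fin 2) :
    annS j * creS k - creS k * annS j = if j = k then 1 else 0 := by
  fin_cases j <;> fin_cases k <;>
  · simp only [Fin.zero_eta, Fin.mk_one, annS, creS, Matrix.cons_val_zero, Matrix.cons_val_one,
      mul_add, add_mul, mul_sub, sub_mul, smul_add, smul_sub, smul_neg, mul_neg, neg_mul,
      smul_mul_assoc, mul_smul_comm, p_mul_x_self,
      p_mul_x_of_ne (zero_ne_one : (0 : Fin 2) ≠ 1), p_mul_x_of_ne (one_ne_zero : (1 : Fin 2) ≠ 0),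
      x_mul_comm 1 0, p_mul_comm 1 0, if_true, zero_ne_one, one_ne_zero, if_false]
    match_scalars <;> ring_nf <;> simp only [I_sq] <;> ring

theorem comm_annS (j k : Fin 2) : annS j * annS k - annS k * annS j = 0 := by
  fin_cases j <;> fin_cases k <;>
  · simp only [Fin.zero_eta, Fin.mk_one, annS, Matrix.cons_val_zero, Matrix.cons_val_one,
      mul_add, add_mul, mul_sub, sub_mul, smul_add, smul_sub, smul_neg, mul_neg, neg_mul,
      smul_mul_assoc, mul_smul_comm, p_mul_x_self,
      p_mul_x_of_ne (zero_ne_one : (0 : Fin 2) ≠ 1), p_mul_x_of_ne (one_ne_zero : (1 : Fin 2) ≠ 0),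
      x_mul_comm 1 0, p_mul_comm 1 0]
    match_scalars <;> ring

theorem comm_creS (j k : Fin 2) : creS j * creS k - creS k * creS j = 0 := by
  fin_cases j <;> fin_cases k <;>
  · simp only [Fin.zero_eta, Fin.mk_one, creS, Matrix.cons_val_zero, Matrix.cons_val_one,
      mul_add, add_mul, mul_sub, sub_mul, smul_add, smul_sub, smul_mul_assoc, mul_smul_comm,
      p_mul_x_self,
      p_mul_x_of_ne (zero_ne_one : (0 : Fin 2) ≠ 1), p_mul_x_of_ne (one_ne_zero : (1 : Fin 2) ≠ 0),
      x_mul_comm 1 0, p_mul_comm 1 0]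
    match_scalars <;> ring

theorem acts_cgd (j : Fin 2) : Acts (cgd j) (annS j) := cgd_eq j ▸ acts_toPMap _

theorem acts_cgd_adjoint (j : Fin 2) : Acts (cgd j).adjoint (creS j) :=
  cgd_eq j ▸ (formalAdj_annS j).acts_adjoint

theorem acts_cgd_adjoint_adjoint (j : Fin 2) : Acts (cgd j).adjoint.adjoint (annS j) :=
  cgd_eq j ▸ (formalAdj_annS j).acts_adjoint_adjoint

theorem isPseudoBosonic_cgd : IsPseudoBosonic schwartzD cgd fun j => (cgd j).adjoint :=
  isPseudoBosonic_of_acts acts_cgd acts_cgd_adjoint acts_cgd_adjoint acts_cgd_adjoint_adjoint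
    comm_annS_creS comm_annS comm_creS

theorem aS_eq (A B s t : ℝ) (j : Fin 2) :
    aS A B s t j = annS j + (kc A B s t j / 2) • 1 := by
  fin_cases j <;>
  · simp only [Fin.zero_eta, Fin.mk_one, aS, X, P, annS, kc, Matrix.cons_val_zero,
      Matrix.cons_val_one]
    match_scalars <;> ring_nf
    simp only [I_sq]
    ring

theorem bS_eq (A B s t : ℝ) (j : Fin 2) :
    bS A B s t j = creS j + (-conj (kc A B s t j) / 2) • 1 := by
  fin_cases j <;>
  · simp only [Fin.zero_eta, Fin.mk_one, bS, X, P, creS, kc, Matrix.cons_val_zero,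
      Matrix.cons_val_one, map_add, map_sub, map_mul, map_div₀, map_one, conj_ofReal, conj_I,
      map_ofNat]
    match_scalars <;> ring_nf
    simp only [I_sq]
    ring

theorem acts_a (A B s t : ℝ) (j : Fin 2) :
    Acts (a A B s t j) (annS j + (kc A B s t j / 2) • 1) :=
  aS_eq A B s t j ▸ acts_toPMap _

theorem acts_b (A B s t : ℝ) (j : Fin 2) :
    Acts (b A B s t j) (creS j + (-conj (kc A B s t j) / 2) • 1) :=
  bS_eq A B s t j ▸ acts_toPMap _

theorem acts_a_adjoint (A B s t : ℝ) (j : Fin 2) :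
    Acts (a A B s t j).adjoint (creS j + (conj (kc A B s t j) / 2) • 1) := by
  rw [a, aS_eq]
  convert ((formalAdj_annS j).add (formalAdj_one.smul (kc A B s t j / 2))).acts_adjoint using 3
  simp only [map_div₀, map_ofNat]

theorem acts_b_adjoint (A B s t : ℝ) (j : Fin 2) :
    Acts (b A B s t j).adjoint (annS j + (-kc A B s t j / 2) • 1) := by
  rw [b, bS_eq]
  convert ((formalAdj_annS j).symm.add
    (formalAdj_one.smul (-conj (kc A B s t j) / 2))).acts_adjoint using 3
  simp only [map_div₀, map_neg, map_ofNat, conj_conj]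

theorem isPseudoBosonic_ab (A B s t : ℝ) :
    IsPseudoBosonic schwartzD (a A B s t) (b A B s t) := by
  refine isPseudoBosonic_of_acts (acts_a A B s t) (acts_b A B s t) (acts_a_adjoint A B s t)
    (acts_b_adjoint A B s t) (fun j k => ?_) (fun j k => ?_) (fun j k => ?_)
  · rw [comm_add_smul_one, comm_annS_creS]
  · rw [comm_add_smul_one, comm_annS]
  · rw [comm_add_smul_one, comm_creS]

theorem annS_gS (j : Fin 2) (β : Fin 2 → ℂ) :
    annS j (gS β) = -((![β 0 + I * β 1, -I * β 0 - β 1] j) / 2) • gS β := by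
  fin_cases j <;>
  · simp only [Fin.zero_eta, Fin.mk_one, annS, Matrix.cons_val_zero, Matrix.cons_val_one,
      smul_apply, add_apply, sub_apply, neg_apply, p_gS]
    match_scalars <;> ring_nf <;> simp only [I_sq] <;> ring

theorem alpha_add_I_mul (A B s t : ℝ) :
    alpha A B s t 0 + I * alpha A B s t 1 = kc A B s t 0 := by
  simp only [alpha, Matrix.cons_val_zero, Matrix.cons_val_one]
  field_simp
  ring

theorem neg_I_mul_alpha_sub (A B s t : ℝ) :
    -I * alpha A B s t 0 - alpha A B s t 1 = kc A B s t 1 := by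
  simp only [alpha, Matrix.cons_val_zero, Matrix.cons_val_one]
  field_simp
  ring_nf
  simp only [I_sq, I_pow_three]
  ring

theorem annS_gS_smul_alpha (A B s t : ℝ) (c : ℂ) (j : Fin 2) :
    annS j (gS (c • alpha A B s t)) = -(c * kc A B s t j / 2) • gS (c • alpha A B s t) := by
  rw [annS_gS]
  congr 2
  fin_cases j
  · simp only [Fin.zero_eta, Matrix.cons_val_zero, ← alpha_add_I_mul, Pi.smul_apply, smul_eq_mul]
    ring
  · simp only [Fin.mk_one, Matrix.cons_val_one, Matrix.cons_val_fin_one, ← neg_I_mul_alpha_sub,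
      Pi.smul_apply, smul_eq_mul]
    ring

theorem annS_gS_zero (j : Fin 2) : annS j (gS 0) = 0 := by
  rw [annS_gS]
  fin_cases j <;> simp

end PseudoBosons

section OscillatorBasis

theorem inner_gauss (β γ : Fin 2 → ℂ) : ⟪gauss β, gauss γ⟫_ℂ =
    Real.pi * cexp (((conj (β 0) + γ 0) ^ 2 + (conj (β 1) + γ 1) ^ 2) / 4) := by
  have h := GaussianFourier.integral_cexp_neg_mul_sum_add (b := 1) (ι := Fin 2) (by simp)
    (fun i => -(conj (β i) + γ i))
  rw [← incl_gS, ← incl_gS, inner_incl, ← (PiLp.volume_preserving_toLp (Fin 2)).integral_comp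
    (MeasurableEquiv.toLp 2 _).measurableEmbedding]
  simp only [Fin.sum_univ_two, Fintype.card_fin, Nat.cast_ofNat, div_one, neg_sq, mul_one, ne_eq,
    OfNat.ofNat_ne_zero, not_false_eq_true, div_self, cpow_one] at h
  rw [← h]
  refine integral_congr_ae (Filter.Eventually.of_forall fun v => ?_)
  simp only [gS_apply, gaussFun, ← exp_conj, ← Complex.exp_add]
  congr 1
  simp only [map_sub, map_add, map_mul, map_neg, map_div₀, map_one, map_ofNat, map_pow, conj_ofReal]
  ring

theorem mul_pow_of_comm_eq_one {R : Type*} [Ring R] {u v : R} (h : u * v - v * u = 1) (n : ℕ) :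
    u * v ^ n = v ^ n * u + n • v ^ (n - 1) := by
  induction n with
  | zero => simp
  | succ n ih =>
    have huv : u * v = v * u + 1 := by rw [← h, add_sub_cancel]
    rcases n with _ | n
    · simpa using huv
    · rw [pow_succ', ← mul_assoc, huv, add_mul, one_mul, mul_assoc, ih, mul_add, ← mul_assoc,
        mul_smul_comm, Nat.add_sub_cancel, Nat.add_sub_cancel, ← pow_succ', ← pow_succ', add_assoc,
        ← succ_nsmul]

theorem annihilator_apply_pow {a c : SOp} (hac : a * c - c * a = 1) {f : 𝓢(Plane, ℂ)}
    (hf : a f = 0) (n : ℕ) : a ((c ^ n) f) = (n : ℂ) • (c ^ (n - 1)) f := by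
  rw [← mul_apply_eq_comp, mul_pow_of_comm_eq_one hac, add_apply, mul_apply_eq_comp, hf, map_zero,
    zero_add, smul_apply, Nat.cast_smul_eq_nsmul]

theorem inner_incl_pow_of_annihilated {a c : SOp} (hadj : FormalAdj a c)
    (hac : a * c - c * a = 1) {f g : 𝓢(Plane, ℂ)} (hf : a f = 0) (hg : a g = 0) (m n : ℕ) :
    ⟪incl ((c ^ m) f), incl ((c ^ n) g)⟫_ℂ = if m = n then m.factorial * ⟪incl f, incl g⟫_ℂ
      else 0 := by
  have hcreate (k : ℕ) (f : 𝓢(Plane, ℂ)) : (c ^ (k + 1)) f = c ((c ^ k) f) := by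
    rw [pow_succ', mul_apply_eq_comp]
  induction m generalizing n with
  | zero =>
    rcases n with _ | n
    · simp
    · rw [hcreate, ← hadj, pow_zero, one_apply_eq_self, hf, map_zero, inner_zero_left,
        if_neg n.succ_ne_zero.symm]
  | succ m ih =>
    rw [hcreate, hadj.symm, annihilator_apply_pow hac hg, map_smul, inner_smul_right, ih]
    rcases n with _ | n
    · simp
    · simp only [Nat.add_sub_cancel, Nat.add_right_cancel_iff, Nat.factorial_succ]
      split_ifs with h <;> simp [h, mul_assoc]

/-- The unnormalized oscillator states `(c_g†)^{n₁} (c_d†)^{n₂} exp(-½(x_1² + x_2²))`. -/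
def oscS (n : ℕ × ℕ) : 𝓢(Plane, ℂ) := (creS 0 ^ n.1) ((creS 1 ^ n.2) (gS 0))

theorem annS_apply_creS_pow_of_ne {j k : Fin 2} (h : j ≠ k) (n : ℕ) (f : 𝓢(Plane, ℂ)) :
    annS j ((creS k ^ n) f) = (creS k ^ n) (annS j f) := by
  have hcomm : Commute (annS j) (creS k) :=
    sub_eq_zero.mp ((comm_annS_creS j k).trans (if_neg h))
  rw [← mul_apply_eq_comp, (hcomm.pow_right n).eq, mul_apply_eq_comp]

theorem annS_zero_creS_one_pow (n : ℕ) : annS 0 ((creS 1 ^ n) (gS 0)) = 0 := by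
  rw [annS_apply_creS_pow_of_ne zero_ne_one, annS_gS_zero, map_zero]

theorem annS_zero_oscS (n : ℕ × ℕ) : annS 0 (oscS n) = (n.1 : ℂ) • oscS (n.1 - 1, n.2) :=
  annihilator_apply_pow (comm_annS_creS 0 0) (annS_zero_creS_one_pow _) _

theorem annS_one_oscS (n : ℕ × ℕ) : annS 1 (oscS n) = (n.2 : ℂ) • oscS (n.1, n.2 - 1) := by
  rw [oscS, annS_apply_creS_pow_of_ne one_ne_zero,
    annihilator_apply_pow (comm_annS_creS 1 1) (annS_gS_zero 1), map_smul, oscS]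

theorem creS_zero_oscS (n : ℕ × ℕ) : creS 0 (oscS n) = oscS (n.1 + 1, n.2) := by
  rw [oscS, oscS, pow_succ', mul_apply_eq_comp]

theorem creS_one_oscS (n : ℕ × ℕ) : creS 1 (oscS n) = oscS (n.1, n.2 + 1) := by
  have hcomm : Commute (creS 1) (creS 0) := sub_eq_zero.mp (comm_creS 1 0)
  rw [oscS, oscS, ← mul_apply_eq_comp, (hcomm.pow_right _).eq, mul_apply_eq_comp, pow_succ',
    mul_apply_eq_comp]

theorem inner_oscS (m n : ℕ × ℕ) : ⟪incl (oscS m), incl (oscS n)⟫_ℂ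
    = if m = n then (m.1.factorial * m.2.factorial * Real.pi : ℂ) else 0 := by
  have hvac : ⟪incl (gS 0), incl (gS 0)⟫_ℂ = Real.pi := by
    rw [incl_gS, inner_gauss]
    simp
  rw [oscS, oscS, inner_incl_pow_of_annihilated (formalAdj_annS 0) (comm_annS_creS 0 0)
    (annS_zero_creS_one_pow _) (annS_zero_creS_one_pow _), inner_incl_pow_of_annihilated
    (formalAdj_annS 1) (comm_annS_creS 1 1) (annS_gS_zero 1) (annS_gS_zero 1), hvac]
  simp only [Prod.ext_iff, mul_ite, mul_zero, mul_assoc, ite_and]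

theorem chi0_eq : chi0 = incl (((1 / Real.sqrt Real.pi : ℝ) : ℂ) • gS 0) := by
  rw [map_smul, incl_gS, chi0]

theorem ev_cgd_chi0 (j : Fin 2) : ev (cgd j) chi0 = 0 := by
  rw [chi0_eq, (acts_cgd j).ev_incl, map_smul, annS_gS_zero, smul_zero, map_zero]

theorem chi_eq (n : ℕ × ℕ) :
    chi n = (ladderConst n * ((1 / Real.sqrt Real.pi : ℝ) : ℂ)) • incl (oscS n) := by
  rw [chi, chi0_eq, ladder_incl acts_cgd_adjoint, map_smul, map_smul, map_smul, smul_smul, oscS]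

theorem orthonormal_chi : Orthonormal ℂ chi := by
  rw [orthonormal_iff_ite]
  intro m n
  rw [chi_eq, chi_eq, inner_smul_left, inner_smul_right, inner_oscS]
  split_ifs with h
  · subst h
    have hnormalized : (Real.sqrt (m.1.factorial * m.2.factorial))⁻¹ * (1 / Real.sqrt Real.pi)
        * ((Real.sqrt (m.1.factorial * m.2.factorial))⁻¹ * (1 / Real.sqrt Real.pi)
        * (m.1.factorial * m.2.factorial * Real.pi)) = 1 := by
      have hfact : (0 : ℝ) < m.1.factorial * m.2.factorial := by positivity
      have hπ := Real.pi_pos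
      field_simp
      rw [Real.sq_sqrt hfact.le, Real.sq_sqrt hπ.le]
    simp only [ladderConst, map_mul, conj_ofReal]
    exact_mod_cast congrArg ofReal hnormalized
  · simp

/-- The span of the oscillator states. -/
def oscSpan : Submodule ℂ 𝓢(Plane, ℂ) := Submodule.span ℂ (Set.range oscS)

theorem oscS_mem_oscSpan (n : ℕ × ℕ) : oscS n ∈ oscSpan := Submodule.subset_span ⟨n, rfl⟩

theorem apply_mem_oscSpan {S : SOp} (hS : ∀ n, S (oscS n) ∈ oscSpan) {f : 𝓢(Plane, ℂ)}
    (hf : f ∈ oscSpan) : S f ∈ oscSpan := by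
  have hle : oscSpan ≤ oscSpan.comap S.toLinearMap :=
    Submodule.span_le.mpr (Set.range_subset_iff.mpr hS)
  exact hle hf

theorem annS_mem_oscSpan (j : Fin 2) {f : 𝓢(Plane, ℂ)} (hf : f ∈ oscSpan) :
    annS j f ∈ oscSpan := by
  refine apply_mem_oscSpan (fun n => ?_) hf
  fin_cases j
  · exact (annS_zero_oscS n).symm ▸ Submodule.smul_mem _ _ (oscS_mem_oscSpan _)
  · exact (annS_one_oscS n).symm ▸ Submodule.smul_mem _ _ (oscS_mem_oscSpan _)

theorem creS_mem_oscSpan (j : Fin 2) {f : 𝓢(Plane, ℂ)} (hf : f ∈ oscSpan) :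
    creS j f ∈ oscSpan := by
  refine apply_mem_oscSpan (fun n => ?_) hf
  fin_cases j
  · exact (creS_zero_oscS n).symm ▸ oscS_mem_oscSpan _
  · exact (creS_one_oscS n).symm ▸ oscS_mem_oscSpan _

theorem x_zero_eq : x 0 = (1 / 2 : ℂ) • (annS 0 + creS 0 + I • (annS 1 - creS 1)) := by
  simp only [annS, creS, Matrix.cons_val_zero, Matrix.cons_val_one]
  match_scalars <;> ring_nf <;> simp only [I_sq] <;> ring

theorem x_one_eq : x 1 = (1 / 2 : ℂ) • (-(I • (annS 0 - creS 0)) - (annS 1 + creS 1)) := by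
  simp only [annS, creS, Matrix.cons_val_zero, Matrix.cons_val_one]
  match_scalars <;> ring_nf <;> simp only [I_sq] <;> ring

theorem linS_mem_oscSpan (β : Fin 2 → ℂ) {f : 𝓢(Plane, ℂ)} (hf : f ∈ oscSpan) :
    linS β f ∈ oscSpan := by
  have ha := fun j => annS_mem_oscSpan j hf
  have hc := fun j => creS_mem_oscSpan j hf
  have hx0 : x 0 f ∈ oscSpan := by
    rw [x_zero_eq]
    exact oscSpan.smul_mem _ (oscSpan.add_mem (oscSpan.add_mem (ha 0) (hc 0))
      (oscSpan.smul_mem _ (oscSpan.sub_mem (ha 1) (hc 1))))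
  have hx1 : x 1 f ∈ oscSpan := by
    rw [x_one_eq]
    exact oscSpan.smul_mem _ (oscSpan.sub_mem (oscSpan.neg_mem
      (oscSpan.smul_mem _ (oscSpan.sub_mem (ha 0) (hc 0)))) (oscSpan.add_mem (ha 1) (hc 1)))
  exact oscSpan.add_mem (oscSpan.smul_mem _ hx0) (oscSpan.smul_mem _ hx1)

theorem neg_linS_pow_gS_mem_oscSpan (β : Fin 2 → ℂ) (n : ℕ) :
    ((-linS β) ^ n) (gS 0) ∈ oscSpan := by
  induction n with
  | zero => simpa [oscS] using oscS_mem_oscSpan 0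
  | succ n ih =>
    rw [pow_succ', mul_apply_eq_comp, neg_apply]
    exact oscSpan.neg_mem (linS_mem_oscSpan β ih)

theorem eq_zero_of_hasDerivAt_succ {F : ℕ → ℂ → ℂ}
    (hderiv : ∀ n w, HasDerivAt (F n) (F (n + 1) w) w) (hzero : ∀ n, F n 0 = 0) (w : ℂ) :
    F 0 w = 0 := by
  have hiter (n : ℕ) : iteratedDeriv n (F 0) = F n := by
    induction n with
    | zero => exact iteratedDeriv_zero
    | succ n ih =>
      rw [iteratedDeriv_succ, ih]
      exact funext fun w => (hderiv n w).deriv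
  rw [← Complex.taylorSeries_eq_of_entire' 0 w fun w => (hderiv 0 w).differentiableAt]
  simp [hiter, hzero]

-- `w ↦ ⟪h, gauss (w • β)⟫` is entire, and its derivatives at `0` are `⟪h, (-β·x)ⁿ gS 0⟫`.
theorem inner_gauss_eq_zero_of_orthogonal_oscSpan {h : Hil}
    (hh : ∀ f ∈ oscSpan, ⟪h, incl f⟫_ℂ = 0) (β : Fin 2 → ℂ) : ⟪h, gauss β⟫_ℂ = 0 := by
  let L (n : ℕ) : 𝓢(Plane, ℂ) →L[ℂ] ℂ :=
    innerSL ℂ h ∘L SchwartzMap.toLpCLM ℂ ℂ 2 volume ∘L (-linS β) ^ n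
  have hderiv (n : ℕ) (w : ℂ) :
      HasDerivAt (fun w => L n (gS (0 + w • β))) (L (n + 1) (gS (0 + w • β))) w := by
    have hnext : L (n + 1) (gS (0 + w • β)) = -L n (linS β (gS (0 + w • β))) := by
      simp only [L, pow_succ, ContinuousLinearMap.comp_apply, mul_apply_eq_comp, neg_apply, map_neg]
    exact hnext ▸ hasDerivAt_gS (L n) 0 β w
  have hzero (n : ℕ) : L n (gS (0 + (0 : ℂ) • β)) = 0 := by
    rw [zero_smul, add_zero]
    exact hh _ (neg_linS_pow_gS_mem_oscSpan β n)
  have h1 : L 0 (gS (0 + (1 : ℂ) • β)) = 0 := eq_zero_of_hasDerivAt_succ hderiv hzero 1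
  rwa [zero_add, one_smul] at h1

open FourierTransform in
theorem ae_eq_zero_of_fourier_eq_zero {V : Type*} [NormedAddCommGroup V] [InnerProductSpace ℝ V]
    [FiniteDimensional ℝ V] [MeasurableSpace V] [BorelSpace V] {k : V → ℂ} (hk : Integrable k)
    (h : ∀ ξ, 𝓕 k ξ = 0) : k =ᵐ[volume] 0 := by
  refine ae_eq_zero_of_integral_contDiff_smul_eq_zero hk.locallyIntegrable fun g hg hgc => ?_
  let G : 𝓢(V, ℂ) := (hgc.comp_left (g := ((↑) : ℝ → ℂ)) rfl).toSchwartzMap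
    (ofRealCLM.contDiff.comp hg)
  let Γ : 𝓢(V, ℂ) := 𝓕⁻ G
  have hΓ : 𝓕 (Γ : V → ℂ) = G := by
    rw [← SchwartzMap.fourier_coe, fourier_fourierInv_eq]
  have hswap := VectorFourier.integral_fourierIntegral_smul_eq_flip (L := innerₗ V)
    (μ := volume) (ν := volume) Real.continuous_fourierChar continuous_inner hk Γ.integrable
  rw [flip_innerₗ] at hswap
  calc ∫ v, g v • k v = ∫ v, k v • 𝓕 (Γ : V → ℂ) v := by
        rw [hΓ]
        exact integral_congr_ae (.of_forall fun v => mul_comm (g v : ℂ) (k v))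
    _ = ∫ ξ, 𝓕 k ξ • Γ ξ := hswap.symm
    _ = 0 := by simp only [h, zero_smul, integral_zero]

theorem eq_zero_of_orthogonal_oscSpan {h : Hil} (hh : ∀ f ∈ oscSpan, ⟪h, incl f⟫_ℂ = 0) :
    h = 0 := by
  have hint : Integrable fun v => conj (h v) * gaussFun 0 v :=
    (Lp.memLp h).star.integrable_mul (memLp_gaussFun 0)
  have hfourier := ae_eq_zero_of_fourier_eq_zero hint fun ξ => by
    let β : Fin 2 → ℂ := fun j => 2 * Real.pi * I * ξ j
    rw [Real.fourier_eq, ← inner_gauss_eq_zero_of_orthogonal_oscSpan hh β, L2.inner_def]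
    refine integral_congr_ae ?_
    filter_upwards [(memLp_gaussFun β).coeFn_toLp] with v hv
    have hchar : gaussFun β v = cexp (↑(2 * Real.pi * -⟪v, ξ⟫_ℝ) * I) * gaussFun 0 v := by
      have hshift := gaussFun_add_smul 0 β 1 v
      rw [zero_add, one_smul] at hshift
      rw [hshift, mul_comm, linForm_apply]
      congr 2
      simp only [β, PiLp.inner_apply, Fin.sum_univ_two, RCLike.inner_apply, conj_trivial]
      push_cast
      ring
    rw [gauss, hv, hchar, Circle.smul_def, Real.fourierChar_apply, smul_eq_mul,
      RCLike.inner_apply]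
    ring
  refine Lp.ext ?_
  filter_upwards [hfourier, Lp.coeFn_zero ℂ 2 (volume : Measure Plane)] with v hv h0
  have hpos : gaussFun 0 v ≠ 0 := Complex.exp_ne_zero _
  simpa [h0, hpos] using hv

theorem incl_oscS_mem_span_chi (n : ℕ × ℕ) :
    incl (oscS n) ∈ Submodule.span ℂ (Set.range chi) := by
  have hne : ladderConst n * ((1 / Real.sqrt Real.pi : ℝ) : ℂ) ≠ 0 := by
    rw [ladderConst, ← ofReal_mul, ofReal_ne_zero]
    positivity
  rw [← inv_smul_smul₀ hne (incl (oscS n)), ← chi_eq]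
  exact Submodule.smul_mem _ _ (Submodule.subset_span ⟨n, rfl⟩)

theorem topologicalClosure_span_chi :
    (Submodule.span ℂ (Set.range chi)).topologicalClosure = ⊤ := by
  rw [Submodule.topologicalClosure_eq_top_iff, Submodule.eq_bot_iff]
  intro h hh
  have hle : oscSpan ≤ (Submodule.span ℂ (Set.range chi)).comap incl :=
    Submodule.span_le.mpr (Set.range_subset_iff.mpr incl_oscS_mem_span_chi)
  exact eq_zero_of_orthogonal_oscSpan fun f hf => Submodule.inner_left_of_mem_orthogonal (hle hf) hh

end OscillatorBasis

section SelfAdjointness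

section Core

variable {H : Type*} [NormedAddCommGroup H] [InnerProductSpace ℂ H]

theorem norm_add_I_smul_sq {u v : H} (h : ⟪v, u⟫_ℂ = ⟪u, v⟫_ℂ) :
    ‖v + I • u‖ ^ 2 = ‖v‖ ^ 2 + ‖u‖ ^ 2 := by
  have him : (⟪v, u⟫_ℂ).im = 0 := by
    rw [← conj_eq_iff_im, inner_conj_symm, h]
  rw [norm_add_sq (𝕜 := ℂ), inner_smul_right, norm_smul, norm_I, one_mul]
  simp [him]

variable [CompleteSpace H]

theorem closure_eq_of_dense_range_add_I {A M : H →ₗ.[ℂ] H} (hM : IsSelfAdjoint M) (hle : A ≤ M)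
    (hdense : DenseRange fun f : A.domain => A f + I • (f : H)) : A.closure = M := by
  have hAM : A.graph ≤ M.graph := LinearPMap.le_graph_of_le hle
  have hsymm {z : H × H} (hz : z ∈ M.graph) : ⟪z.2, z.1⟫_ℂ = ⟪z.1, z.2⟫_ℂ := by
    obtain ⟨f, hf1, hf2⟩ := (LinearPMap.mem_graph_iff M).mp hz
    have h := LinearPMap.adjoint_isFormalAdjoint hM.dense_domain
    rw [LinearPMap.isSelfAdjoint_def.mp hM] at h
    rw [← hf1, ← hf2, h f f]
  have hgraph : A.graph.topologicalClosure = M.graph := by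
    refine le_antisymm (A.graph.topologicalClosure_minimal hAM hM.isClosed) fun z hz => ?_
    refine Metric.mem_closure_iff.mpr fun ε hε => ?_
    obtain ⟨f, hf⟩ := hdense.exists_dist_lt (z.2 + I • z.1) hε
    refine ⟨_, A.mem_graph f, lt_of_le_of_lt ?_ hf⟩
    have hd := norm_add_I_smul_sq (hsymm (M.graph.sub_mem hz (hAM (A.mem_graph f))))
    have hsum : z.2 + I • z.1 - (A f + I • (f : H)) = (z.2 - A f) + I • (z.1 - f) := by module
    rw [Prod.dist_eq, dist_eq_norm, dist_eq_norm, dist_eq_norm, hsum]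
    exact max_le
      ((pow_le_pow_iff_left₀ (norm_nonneg _) (norm_nonneg _) two_ne_zero).mp <|
      hd ▸ le_add_of_nonneg_left (sq_nonneg _))
      ((pow_le_pow_iff_left₀ (norm_nonneg _) (norm_nonneg _) two_ne_zero).mp <|
      hd ▸ le_add_of_nonneg_right (sq_nonneg _))
  have hclosable : A.IsClosable := ⟨M, hgraph⟩
  exact LinearPMap.eq_of_eq_graph (hclosable.graph_closure_eq_closure_graph.symm.trans hgraph)

end Core

section PhaseUnitary

variable {X : Type*} [MeasurableSpace X] {μ : Measure X} {S : X → ℝ}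

theorem memLp_top_phase (hS : Measurable S) : MemLp (fun x => cexp (S x * I)) ⊤ μ :=
  memLp_top_of_bound (by fun_prop) 1 (.of_forall fun x => (norm_exp_ofReal_mul_I (S x)).le)

theorem norm_boundedMul_phase (hS : Measurable S) (f : Lp ℂ 2 μ) :
    ‖boundedMul 2 (memLp_top_phase hS) f‖ = ‖f‖ := by
  have hnorm : ∀ᵐ x ∂μ, ‖boundedMul 2 (memLp_top_phase hS) f x‖ = ‖f x‖ := by
    filter_upwards [coeFn_boundedMul (memLp_top_phase hS) f] with x hx
    rw [hx, norm_mul, norm_exp_ofReal_mul_I, one_mul]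
  exact le_antisymm (Lp.norm_le_norm_of_ae_le (hnorm.mono fun _ => le_of_eq))
    (Lp.norm_le_norm_of_ae_le (hnorm.mono fun _ => ge_of_eq))

theorem boundedMul_phase_neg (hS : Measurable S) (f : Lp ℂ 2 μ) :
    boundedMul 2 (memLp_top_phase hS) (boundedMul 2 (memLp_top_phase hS.neg) f) = f := by
  refine Lp.ext ?_
  filter_upwards [coeFn_boundedMul (memLp_top_phase hS.neg) f,
    coeFn_boundedMul (memLp_top_phase hS) (boundedMul 2 (memLp_top_phase hS.neg) f)] with x h h'
  rw [h', h, ← mul_assoc, ← Complex.exp_add]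
  simp

/-- Multiplication by the phase `exp(iS)`, as a unitary operator. -/
def phaseUnitary (hS : Measurable S) : Lp ℂ 2 μ ≃ₗᵢ[ℂ] Lp ℂ 2 μ :=
  LinearIsometryEquiv.ofSurjective
    ⟨(boundedMul 2 (memLp_top_phase hS)).toLinearMap, norm_boundedMul_phase hS⟩
    fun f => ⟨_, boundedMul_phase_neg hS f⟩

theorem coeFn_phaseUnitary (hS : Measurable S) (f : Lp ℂ 2 μ) :
    phaseUnitary hS f =ᵐ[μ] fun x => cexp (S x * I) * f x :=
  coeFn_boundedMul (memLp_top_phase hS) f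

end PhaseUnitary

section SchwartzPhase

open scoped LineDeriv

/-- Multiplication of Schwartz functions by the phase `exp(iS)`. -/
def phaseS {E : Type*} [NormedAddCommGroup E] [NormedSpace ℝ E] (S : E → ℝ) :
    𝓢(E, ℂ) →L[ℂ] 𝓢(E, ℂ) :=
  SchwartzMap.smulLeftCLM ℂ fun v => cexp (S v * I)

variable {E : Type*} [NormedAddCommGroup E] [NormedSpace ℝ E] {S : E → ℝ}

theorem phaseS_apply (hS : S.HasTemperateGrowth) (f : 𝓢(E, ℂ)) (v : E) :
    phaseS S f v = cexp (S v * I) * f v :=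
  SchwartzMap.smulLeftCLM_apply_apply (hasTemperateGrowth_cexp_mul_I hS) f v

theorem phaseS_surjective (hS : S.HasTemperateGrowth) : Function.Surjective (phaseS S) := by
  refine fun f => ⟨phaseS (-S) f, ?_⟩
  ext v
  rw [phaseS_apply hS, phaseS_apply hS.neg, ← mul_assoc, ← Complex.exp_add]
  simp

theorem lineDerivOp_phaseS (hS : S.HasTemperateGrowth) (w : E) (f : 𝓢(E, ℂ)) (v : E) :
    ∂_{w} (phaseS S f) v
      = cexp (S v * I) * (I * (fderiv ℝ S v w : ℝ) * f v + fderiv ℝ f v w) := by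
  have hSv := (hS.1.differentiable (by simp) v).hasFDerivAt
  have hprod := (((ofRealCLM.hasFDerivAt.comp v hSv).mul_const I).cexp).mul (f.hasFDerivAt v)
  have hfderiv : fderiv ℝ (phaseS S f) v = _ :=
    (congrArg (fderiv ℝ · v) (funext (phaseS_apply hS f))).trans hprod.fderiv
  rw [SchwartzMap.lineDerivOp_apply_eq_fderiv, hfderiv]
  simp only [Function.comp_apply, ofRealCLM_apply, add_apply, smul_apply, smul_eq_mul,
    ContinuousLinearMap.comp_apply]
  ring

theorem phaseUnitary_incl {S : Plane → ℝ} (hS : S.HasTemperateGrowth) (f : 𝓢(Plane, ℂ)) :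
    phaseUnitary hS.1.continuous.measurable (incl f) = incl (phaseS S f) := by
  refine Lp.ext ?_
  filter_upwards [coeFn_phaseUnitary hS.1.continuous.measurable (incl f), coeFn_incl f,
    coeFn_incl (phaseS S f)] with v hphase hf hphaseS
  rw [hphase, hf, hphaseS, phaseS_apply hS]

end SchwartzPhase

section LinearForms

variable {E : Type*} [NormedAddCommGroup E] [InnerProductSpace ℝ E]

theorem hasTemperateGrowth_inner (l : E) : Function.HasTemperateGrowth fun v : E => ⟪l, v⟫_ℝ :=
  (innerSL ℝ l).hasTemperateGrowth

theorem ofReal_add_I_ne_zero (r : ℝ) : (r : ℂ) + I ≠ 0 := fun h => by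
  simpa using congrArg im h

theorem hasTemperateGrowth_inv_ofReal_add_I :
    Function.HasTemperateGrowth fun r : ℝ => ((r : ℂ) + I)⁻¹ := by
  have hfun : (fun r : ℝ => ((r : ℂ) + I)⁻¹)
      = (ofReal - fun _ => I) * (ofReal ∘ fun r : ℝ => (1 + ‖r‖ ^ 2) ^ (-1 : ℝ)) := by
    funext r
    have hr : (r : ℂ) - I ≠ 0 := fun h => by simpa using congrArg im h
    have hfactor : 1 + (r : ℂ) ^ 2 = (r + I) * (r - I) := by linear_combination I_sq
    simp only [Pi.mul_apply, Pi.sub_apply, Function.comp_apply, Real.rpow_neg_one, ofReal_inv,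
      Real.norm_eq_abs, sq_abs, ofReal_add, ofReal_one, ofReal_pow, hfactor]
    field_simp [ofReal_add_I_ne_zero r]
  rw [hfun]
  exact (Function.Complex.hasTemperateGrowth_ofReal.sub (.const I)).mul
    (Function.Complex.hasTemperateGrowth_ofReal.comp
      (Function.hasTemperateGrowth_one_add_norm_sq_rpow ℝ (-1)))

-- `S` solves `∂_w S = ⟪u, ·⟫` along the lines parallel to `w`.
theorem exists_hasTemperateGrowth_fderiv_eq_inner (u : E) {w : E} (hw : w ≠ 0) :
    ∃ S : E → ℝ, S.HasTemperateGrowth ∧ ∀ v, fderiv ℝ S v w = ⟪u, v⟫_ℝ := by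
  have hww : ⟪w, w⟫_ℝ ≠ 0 := inner_self_ne_zero.mpr hw
  refine ⟨fun v => (⟪w, w⟫_ℝ)⁻¹ * (⟪u, v⟫_ℝ * ⟪w, v⟫_ℝ)
    - ⟪u, w⟫_ℝ / (2 * ⟪w, w⟫_ℝ ^ 2) * ⟪w, v⟫_ℝ ^ 2, ?_, fun v => ?_⟩
  · exact ((Function.HasTemperateGrowth.const _).mul
      ((hasTemperateGrowth_inner u).mul (hasTemperateGrowth_inner w))).sub
      ((Function.HasTemperateGrowth.const _).mul ((hasTemperateGrowth_inner w).pow 2))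
  · have hinner (z : E) : HasFDerivAt (fun v => ⟪z, v⟫_ℝ) (innerSL ℝ z) v :=
      (innerSL ℝ z).hasFDerivAt
    have h := (((hinner u).mul (hinner w)).const_mul (⟪w, w⟫_ℝ)⁻¹).sub
      (((hinner w).pow 2).const_mul (⟪u, w⟫_ℝ / (2 * ⟪w, w⟫_ℝ ^ 2)))
    refine (congrArg (· w) h.fderiv).trans ?_
    simp only [sub_apply, smul_apply, add_apply, innerSL_apply_apply, smul_eq_mul]
    field_simp
    ring

end LinearForms

section Multiplication

theorem closure_toPMap_isMultiplication {K : SOp} {U : Hil ≃ₗᵢ[ℂ] Hil}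
    {V : 𝓢(Plane, ℂ) → 𝓢(Plane, ℂ)} {l : Plane} (hU : ∀ f, U (incl f) = incl (V f))
    (hV : Function.Surjective V) (hK : ∀ f v, V (K f) v = (⟪l, v⟫_ℝ : ℝ) * V f v) :
    IsMultiplication U (fun v => ⟪l, v⟫_ℝ) (toPMap K).closure := by
  have hg : Measurable fun v : Plane => ⟪l, v⟫_ℝ := by fun_prop
  obtain ⟨M, hM⟩ := exists_isMultiplication U hg
  have hle : toPMap K ≤ M := LinearPMap.le_of_le_graph <| by
    rintro ⟨_, _⟩ hmem
    obtain ⟨⟨_, f, rfl⟩, rfl, rfl⟩ := (LinearPMap.mem_graph_iff _).mp hmem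
    rw [hM, toPMap_apply_incl, hU, hU]
    filter_upwards [coeFn_incl (V f), coeFn_incl (V (K f))] with v hf hKf
    rw [hf, hKf, hK]
  have hdense : DenseRange fun f : (toPMap K).domain => toPMap K f + I • (f : Hil) := by
    refine (U.symm.surjective.denseRange.dense_image U.symm.continuous dense_schwartzD).mono ?_
    rintro _ ⟨_, ⟨f, rfl⟩, rfl⟩
    have hres : Function.HasTemperateGrowth fun v : Plane => ((⟪l, v⟫_ℝ : ℝ) + I : ℂ)⁻¹ :=
      hasTemperateGrowth_inv_ofReal_add_I.comp (hasTemperateGrowth_inner l)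
    obtain ⟨q, hq⟩ := hV (SchwartzMap.smulLeftCLM ℂ (fun v => ((⟪l, v⟫_ℝ : ℝ) + I : ℂ)⁻¹) f)
    refine ⟨⟨incl q, incl_mem q⟩, ?_⟩
    simp only [toPMap_apply_incl]
    rw [LinearIsometryEquiv.eq_symm_apply, map_add, map_smul, hU, hU, ← map_smul, ← map_add]
    congr 1
    ext v
    simp only [add_apply, hK, smul_apply, smul_eq_mul, ← add_mul, hq]
    rw [SchwartzMap.smulLeftCLM_apply_apply hres, smul_eq_mul,
      mul_inv_cancel_left₀ (ofReal_add_I_ne_zero _)]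
  exact closure_eq_of_dense_range_add_I (hM.isSelfAdjoint hg) hle hdense ▸ hM

end Multiplication

section Exponent

open scoped LineDeriv FourierTransform

/-- The operator `-(Re β · x + Im β · p)`. -/
def expS (β : Fin 2 → ℂ) : SOp :=
  -(((β 0).re : ℂ) • x 0 + ((β 1).re : ℂ) • x 1 + ((β 0).im : ℂ) • p 0 + ((β 1).im : ℂ) • p 1)

theorem expS_apply (β : Fin 2 → ℂ) (f : 𝓢(Plane, ℂ)) (v : Plane) :
    expS β f v = I * fderiv ℝ f v (!₂[(β 0).im, (β 1).im] : Plane)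
      - ((⟪(!₂[(β 0).re, (β 1).re] : Plane), v⟫_ℝ : ℝ) : ℂ) * f v := by
  have hcoord : (!₂[(β 0).im, (β 1).im] : Plane) = (β 0).im • EuclideanSpace.single 0 (1 : ℝ)
      + (β 1).im • EuclideanSpace.single 1 (1 : ℝ) := by
    ext j
    fin_cases j <;> simp
  rw [hcoord, map_add, map_smul, map_smul]
  simp only [expS, neg_apply, add_apply, smul_apply, x_apply, p_apply, smul_eq_mul,
    Complex.real_smul, PiLp.inner_apply, Fin.sum_univ_two, RCLike.inner_apply, Matrix.cons_val_zero,
    Matrix.cons_val_one, Matrix.cons_val_fin_one, Real.ringHom_apply, ofReal_add, ofReal_mul]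
  ring

theorem phaseS_expS {β : Fin 2 → ℂ} {S : Plane → ℝ} (hS : S.HasTemperateGrowth)
    (hSβ : ∀ v, fderiv ℝ S v !₂[(β 0).im, (β 1).im] = ⟪(!₂[(β 0).re, (β 1).re] : Plane), v⟫_ℝ)
    (f : 𝓢(Plane, ℂ)) :
    phaseS S (expS β f) = I • ∂_{(!₂[(β 0).im, (β 1).im] : Plane)} (phaseS S f) := by
  ext v
  rw [phaseS_apply hS, expS_apply, smul_apply, lineDerivOp_phaseS hS, hSβ, smul_eq_mul]
  linear_combination (-cexp (S v * I) * (⟪(!₂[(β 0).re, (β 1).re] : Plane), v⟫_ℝ : ℝ) * f v) * I_sq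

theorem fourier_I_smul_lineDerivOp_apply (w : Plane) (f : 𝓢(Plane, ℂ)) (v : Plane) :
    𝓕 (I • ∂_{w} f) v = ((⟪-(2 * Real.pi) • w, v⟫_ℝ : ℝ) : ℂ) * 𝓕 f v := by
  rw [FourierTransform.fourier_smul, SchwartzMap.fourier_lineDerivOp_eq, smul_apply, smul_apply,
    SchwartzMap.smulLeftCLM_apply_apply (Function.hasTemperateGrowth_inner_left w),
    real_inner_smul_left, real_inner_comm w v, Complex.real_smul, smul_eq_mul, smul_eq_mul]
  push_cast
  linear_combination (2 * Real.pi * (⟪w, v⟫_ℝ : ℝ) * 𝓕 f v) * I_sq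

-- A phase turns the operator into `i ∂_w`, which the Fourier transform diagonalizes.
theorem exists_isMultiplication_closure_expS (β : Fin 2 → ℂ) :
    ∃ (U : Hil ≃ₗᵢ[ℂ] Hil) (l : Plane),
      IsMultiplication U (fun v => ⟪l, v⟫_ℝ) (toPMap (expS β)).closure := by
  by_cases him : (!₂[(β 0).im, (β 1).im] : Plane) = 0
  · refine ⟨LinearIsometryEquiv.refl ℂ Hil, -!₂[(β 0).re, (β 1).re],
      closure_toPMap_isMultiplication (V := id) (fun _ => rfl) Function.surjective_id
      fun f v => ?_⟩
    rw [id, id, expS_apply, him, map_zero, mul_zero, zero_sub, inner_neg_left, ofReal_neg, neg_mul]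
  · obtain ⟨S, hS, hSβ⟩ :=
      exists_hasTemperateGrowth_fderiv_eq_inner (!₂[(β 0).re, (β 1).re] : Plane) him
    refine ⟨(phaseUnitary hS.1.continuous.measurable).trans (Lp.fourierTransformₗᵢ Plane ℂ),
      -(2 * Real.pi) • !₂[(β 0).im, (β 1).im],
      closure_toPMap_isMultiplication (V := fun f => 𝓕 (phaseS S f)) (fun f => ?_)
      ((FourierTransform.fourierEquiv ℂ 𝓢(Plane, ℂ)).surjective.comp (phaseS_surjective hS))
      fun f v => ?_⟩
    · rw [LinearIsometryEquiv.trans_apply, phaseUnitary_incl hS]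
      exact SchwartzMap.toLp_fourier_eq _
    · rw [phaseS_expS hS hSβ, fourier_I_smul_lineDerivOp_apply]

theorem expS_alpha (A B s t : ℝ) : expS (alpha A B s t) =
    (-(1 / 2) : ℂ) • (kc A B s t 0 • creS 0 + kc A B s t 1 • creS 1
      + conj (kc A B s t 0) • annS 0 + conj (kc A B s t 1) • annS 1) := by
  rw [← alpha_add_I_mul, ← neg_I_mul_alpha_sub, expS]
  simp only [annS, creS, Matrix.cons_val_zero, Matrix.cons_val_one, Matrix.cons_val_fin_one,
    re_eq_add_conj, im_eq_sub_conj, map_add, map_sub, map_mul, map_neg, conj_I, div_mul_eq_div_div,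
    div_I]
  match_scalars <;> ring_nf <;> simp only [I_sq] <;> ring

theorem Acts.apply_eq {A : Hil →ₗ.[ℂ] Hil} {S : SOp} (h : Acts A S) (f : 𝓢(Plane, ℂ))
    (hf : incl f ∈ A.domain) : A ⟨incl f, hf⟩ = incl (S f) :=
  A.mem_graph_snd_inj (A.mem_graph ⟨incl f, hf⟩) (h f) rfl

theorem exponent_eq (A B s t : ℝ) : exponent A B s t = toPMap (expS (alpha A B s t)) := by
  have hdom (j : Fin 2) : (cgd j).domain = schwartzD := by rw [cgd_eq]; rfl
  have hadj (j : Fin 2) : schwartzD ≤ (cgd j).adjoint.domain := (acts_cgd_adjoint j).stable.1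
  refine LinearPMap.ext ?_ ?_
  · change (((cgd 0).adjoint.domain ⊓ (cgd 1).adjoint.domain) ⊓ (cgd 0).domain) ⊓ (cgd 1).domain
      = schwartzD
    rw [hdom, hdom]
    exact le_antisymm inf_le_right
      (le_inf (le_inf (le_inf (hadj 0) (hadj 1)) le_rfl) le_rfl)
  · rintro _ hexp ⟨f, rfl⟩
    obtain ⟨⟨⟨hc0', hc1'⟩, hc0⟩, hc1⟩ := hexp
    rw [toPMap_apply_incl, expS_alpha]
    change (-(1 / 2) : ℂ) • (kc A B s t 0 • (cgd 0).adjoint ⟨incl f, hc0'⟩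
      + kc A B s t 1 • (cgd 1).adjoint ⟨incl f, hc1'⟩ + conj (kc A B s t 0) • cgd 0 ⟨incl f, hc0⟩
      + conj (kc A B s t 1) • cgd 1 ⟨incl f, hc1⟩) = _
    rw [(acts_cgd_adjoint 0).apply_eq, (acts_cgd_adjoint 1).apply_eq, (acts_cgd 0).apply_eq,
      (acts_cgd 1).apply_eq]
    simp only [smul_apply, add_apply, map_smul, map_add]

theorem exists_isExp_exponent (A B s t : ℝ) :
    IsSelfAdjoint (exponent A B s t).closure ∧ ∃ T, IsExp (exponent A B s t).closure T := by
  obtain ⟨U, l, hU⟩ := exists_isMultiplication_closure_expS (alpha A B s t)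
  have hl : Measurable fun v : Plane => ⟪l, v⟫_ℝ := by fun_prop
  obtain ⟨T, hT⟩ := exists_isMultiplication U (Real.measurable_exp.comp hl)
  rw [exponent_eq]
  exact ⟨hU.isSelfAdjoint hl, T, Plane, inferInstance, volume, U, _, hl, hU, hT⟩

end Exponent

end SelfAdjointness

section Evolution

/-- The curve `f` solves the evolution equation `f' = K f` in `𝓢(ℝ²)`; the derivative is taken
after applying an arbitrary continuous linear map to `L²(ℝ²)`. -/
def IsEvolution (K : SOp) (f : ℝ → 𝓢(Plane, ℂ)) : Prop :=
  ∀ (L : 𝓢(Plane, ℂ) →L[ℂ] Hil) (τ : ℝ), HasDerivAt (fun τ => L (f τ)) (L (K (f τ))) τ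

namespace IsEvolution

variable {K D : SOp} {f : ℝ → 𝓢(Plane, ℂ)} {κ : ℂ}

theorem hasDerivAt_incl (hf : IsEvolution K f) (τ : ℝ) :
    HasDerivAt (fun τ => incl (f τ)) (incl (K (f τ))) τ :=
  hf (SchwartzMap.toLpCLM ℂ ℂ 2 volume) τ

theorem sub_smul_apply (hf : IsEvolution K f) (hKD : K * D = D * K - κ • 1) :
    IsEvolution K fun τ => (D - ((τ : ℂ) * κ) • 1) (f τ) := fun L τ => by
  have hκ : HasDerivAt (fun τ : ℝ => (τ : ℂ) * κ) κ τ := by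
    simpa using (hasDerivAt_id τ).ofReal_comp.mul_const κ
  have hcomm : K (D (f τ)) = D (K (f τ)) - κ • f τ := congrArg (fun S : SOp => S (f τ)) hKD
  convert! (hf (L.comp D) τ).sub (hκ.smul (hf L τ)) using 1
  · funext τ
    simp only [sub_apply, smul_apply, one_apply_eq_self, map_sub, map_smul]
    rfl
  · simp only [sub_apply, smul_apply, one_apply_eq_self, map_sub, map_smul, hcomm,
      ContinuousLinearMap.comp_apply]
    module

theorem sub_smul_pow_apply (hf : IsEvolution K f) (hKD : K * D = D * K - κ • 1) (n : ℕ) :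
    IsEvolution K fun τ => ((D - ((τ : ℂ) * κ) • 1) ^ n) (f τ) := by
  induction n with
  | zero => simpa using hf
  | succ n ih =>
    simp only [pow_succ']
    exact ih.sub_smul_apply hKD

end IsEvolution

/-- The complex bilinear pairing of `Im β` with `δ`. -/
def imDot (β δ : Fin 2 → ℂ) : ℂ := ((β 0).im : ℂ) * δ 0 + ((β 1).im : ℂ) * δ 1

theorem imDot_smul (β δ : Fin 2 → ℂ) (w : ℂ) : imDot β (w • δ) = w * imDot β δ := by
  simp only [imDot, Pi.smul_apply, smul_eq_mul]
  ring

theorem expS_gS (β δ : Fin 2 → ℂ) :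
    expS β (gS δ) = -linS β (gS δ) - (I * imDot β δ) • gS δ := by
  have hre_im (j : Fin 2) : β j • x j (gS δ) = (((β j).re : ℂ) + (β j).im * I) • x j (gS δ) := by
    rw [re_add_im]
  simp only [expS, linS, neg_apply, add_apply, smul_apply, p_gS, imDot, hre_im]
  module

/-- The solution of `f' = expS β f` that starts at the Gaussian `exp (-½ (x₁² + x₂²))`. -/
def gaussCurve (β : Fin 2 → ℂ) (τ : ℝ) : 𝓢(Plane, ℂ) :=
  cexp (-I * (τ ^ 2 / 2 * imDot β β)) • gS ((τ : ℂ) • β)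

theorem isEvolution_gaussCurve (β : Fin 2 → ℂ) : IsEvolution (expS β) (gaussCurve β) :=
    fun L τ => by
  have hgS : HasDerivAt (fun τ : ℝ => L (gS ((τ : ℂ) • β))) (-L (linS β (gS ((τ : ℂ) • β)))) τ := by
    simpa [Function.comp_def] using
      (hasDerivAt_gS L 0 β τ).scomp τ ofRealCLM.hasDerivAt
  have hphase : HasDerivAt (fun τ : ℝ => cexp (-I * (τ ^ 2 / 2 * imDot β β)))
      (cexp (-I * (τ ^ 2 / 2 * imDot β β)) * (-I * (τ * imDot β β))) τ := by
    refine HasDerivAt.cexp (HasDerivAt.const_mul _ ?_)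
    simpa using ((((hasDerivAt_id τ).ofReal_comp).pow 2).div_const 2).mul_const (imDot β β)
  convert! hphase.smul hgS using 1
  · simp only [gaussCurve, map_smul]
    rfl
  · simp only [gaussCurve, map_smul, expS_gS, imDot_smul, map_sub, map_neg]
    module

theorem expS_mul_creS (A B s t : ℝ) (j : Fin 2) : expS (alpha A B s t) * creS j
    = creS j * expS (alpha A B s t) - (conj (kc A B s t j) / 2) • 1 := by
  have hann (i : Fin 2) : annS i * creS j = creS j * annS i + if i = j then 1 else 0 :=
    eq_add_of_sub_eq' (comm_annS_creS i j)
  have hcre (i : Fin 2) : creS i * creS j = creS j * creS i := sub_eq_zero.mp (comm_creS i j)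
  simp only [expS_alpha, smul_mul_assoc, mul_smul_comm, add_mul, mul_add, hann, hcre]
  fin_cases j
  all_goals
    simp only [Fin.zero_eta, Fin.mk_one, if_true, zero_ne_one, one_ne_zero, if_false]
    module

/-- The creation operator `creS j` transported along the evolution generated by
`expS (alpha A B s t)`. -/
def creCurve (A B s t τ : ℝ) (j : Fin 2) : SOp :=
  creS j - ((τ : ℂ) * (conj (kc A B s t j) / 2)) • 1

/-- The solution of `f' = expS (alpha A B s t) f` that starts at the `n`-th unnormalized oscillator
state. -/
def ladderCurve (A B s t : ℝ) (n : ℕ × ℕ) (τ : ℝ) : 𝓢(Plane, ℂ) :=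
  (creCurve A B s t τ 0 ^ n.1) ((creCurve A B s t τ 1 ^ n.2) (gaussCurve (alpha A B s t) τ))

theorem isEvolution_ladderCurve (A B s t : ℝ) (n : ℕ × ℕ) :
    IsEvolution (expS (alpha A B s t)) (ladderCurve A B s t n) :=
  ((isEvolution_gaussCurve _).sub_smul_pow_apply (expS_mul_creS A B s t 1) n.2).sub_smul_pow_apply
    (expS_mul_creS A B s t 0) n.1

end Evolution

section Exponential

variable {H : Type*} [NormedAddCommGroup H] [InnerProductSpace ℂ H] {K T : H →ₗ.[ℂ] H}

namespace IsExp

theorem isSelfAdjoint [CompleteSpace H] (h : IsExp K T) : IsSelfAdjoint T := by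
  obtain ⟨X, _, μ, U, g, hg, -, hT⟩ := h
  exact hT.isSelfAdjoint (Real.measurable_exp.comp hg)

theorem inner_symm (h : IsExp K T) {f f' k k' : H} (hf : (f, f') ∈ T.graph)
    (hk : (k, k') ∈ T.graph) : ⟪f', k⟫_ℂ = ⟪f, k'⟫_ℂ := by
  obtain ⟨X, _, μ, U, g, -, -, hT⟩ := h
  exact hT.inner_symm hf hk

theorem ker_eq_bot (h : IsExp K T) : LinearMap.ker T.toFun = ⊥ := by
  obtain ⟨X, _, μ, U, g, -, -, hT⟩ := h
  refine LinearMap.ker_eq_bot'.mpr fun f (hf : T f = 0) => ?_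
  have hmul := (hT _ _).mp (T.mem_graph f)
  rw [hf, map_zero] at hmul
  have hU : U (f : H) = 0 := by
    refine Lp.ext ?_
    filter_upwards [hmul, Lp.coeFn_zero ℂ 2 μ] with x hx hzero
    rw [hzero, Pi.zero_apply, zero_eq_mul, ofReal_eq_zero] at hx
    rw [hzero, Pi.zero_apply, hx.resolve_left (Real.exp_ne_zero _)]
  exact Subtype.ext (by simpa using hU)

theorem mem_graph_inverse (h : IsExp K T) {f f' : H} (hf : (f, f') ∈ T.graph) :
    (f', f) ∈ T.inverse.graph := by
  rw [LinearPMap.inverse_graph h.ker_eq_bot]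
  exact ⟨(f, f'), hf, rfl⟩

theorem mem_domain_inf_inverse_domain (h : IsExp K T) {f₀ f f₁ : H} (h₀ : (f₀, f) ∈ T.graph)
    (h₁ : (f, f₁) ∈ T.graph) : f ∈ T.domain ⊓ T.inverse.domain :=
  ⟨LinearPMap.mem_domain_of_mem_graph h₁,
    LinearPMap.mem_domain_of_mem_graph (h.mem_graph_inverse h₀)⟩

theorem mem_graph_of_hasDerivAt (h : IsExp K T) {f k : ℝ → H}
    (hf : ∀ τ, HasDerivAt f (k τ) τ) (hk : ∀ τ, (f τ, k τ) ∈ K.graph) (τ : ℝ) :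
    (f τ, f (τ + 1)) ∈ T.graph := by
  obtain ⟨X, _, μ, U, g, hg, hK, hT⟩ := h
  rw [hT]
  filter_upwards [hK.ae_eq_exp_of_hasDerivAt hg hf hk τ,
    hK.ae_eq_exp_of_hasDerivAt hg hf hk (τ + 1)] with x hτ hτ'
  rw [hτ, hτ', ← mul_assoc, ← ofReal_mul, ← Real.exp_add, add_one_mul, add_comm]

theorem hasSum_inner_mul_inner (h : IsExp K T) {ι : Type*} (e : HilbertBasis ι ℂ H) {φ Ψ : ι → H}
    (hφ : ∀ n, (e n, φ n) ∈ T.graph) (hΨ : ∀ n, (Ψ n, e n) ∈ T.graph) {f f' g g' : H}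
    (hf : (f, f') ∈ T.graph) (hg : (g', g) ∈ T.graph) :
    HasSum (fun n => ⟪f, φ n⟫_ℂ * ⟪Ψ n, g⟫_ℂ) ⟪f, g⟫_ℂ := by
  have hsum := e.hasSum_inner_mul_inner f' g'
  rw [h.inner_symm hf hg] at hsum
  simpa only [h.inner_symm hf (hφ _), h.inner_symm (hΨ _) hg] using hsum

end IsExp

theorem exists_mem_graph_of_mem_inverse_domain {f : H} (hf : f ∈ T.inverse.domain) :
    ∃ f', (f', f) ∈ T.graph := by
  rw [LinearPMap.inverse_domain] at hf
  obtain ⟨f', rfl⟩ := hf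
  exact ⟨f', T.mem_graph f'⟩

section QuasiBases

variable {ι : Type*} {G : Submodule ℂ H} {φ Ψ : ι → H}

theorem hasSum_inner_mul_inner_swap {f g : H}
    (h : HasSum (fun n => ⟪g, φ n⟫_ℂ * ⟪Ψ n, f⟫_ℂ) ⟪g, f⟫_ℂ) :
    HasSum (fun n => ⟪f, Ψ n⟫_ℂ * ⟪φ n, g⟫_ℂ) ⟪f, g⟫_ℂ := by
  simpa only [map_mul, inner_conj_symm, mul_comm] using (Complex.hasSum_conj').mpr h

theorem IsExp.isQuasiBases (h : IsExp K T) (e : HilbertBasis ι ℂ H)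
    (hφ : ∀ n, (e n, φ n) ∈ T.graph) (hΨ : ∀ n, (Ψ n, e n) ∈ T.graph)
    (hφT : ∀ n, φ n ∈ T.domain) (hΨT : ∀ n, Ψ n ∈ T.inverse.domain) :
    IsQuasiBases (T.domain ⊓ T.inverse.domain) φ Ψ := by
  have hsum {f g : H} (hf : f ∈ T.domain) (hg : g ∈ T.inverse.domain) :
      HasSum (fun n => ⟪f, φ n⟫_ℂ * ⟪Ψ n, g⟫_ℂ) ⟪f, g⟫_ℂ := by
    obtain ⟨g', hg'⟩ := exists_mem_graph_of_mem_inverse_domain hg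
    exact h.hasSum_inner_mul_inner e hφ hΨ (T.mem_graph ⟨f, hf⟩) hg'
  refine ⟨?_, fun n => ⟨hφT n, LinearPMap.mem_domain_of_mem_graph (h.mem_graph_inverse (hφ n))⟩,
    fun n => ⟨LinearPMap.mem_domain_of_mem_graph (hΨ n), hΨT n⟩,
    fun f hf g hg => hsum hf.1 hg.2,
    fun f hf g hg => hasSum_inner_mul_inner_swap (hsum hg.1 hf.2)⟩
  have hspan : Submodule.span ℂ (Set.range e) ≤ T.domain ⊓ T.inverse.domain := by
    rw [Submodule.span_le]
    rintro _ ⟨n, rfl⟩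
    exact h.mem_domain_inf_inverse_domain (hΨ n) (hφ n)
  exact (Submodule.dense_iff_topologicalClosure_eq_top.mpr e.dense_span).mono hspan

theorem IsQuasiBases.smul (h : IsQuasiBases G φ Ψ) {c d : ℂ} (hcd : conj c * d = 1) :
    IsQuasiBases G (fun n => c • φ n) (fun n => d • Ψ n) := by
  have hsum {f g : H} (hf : f ∈ G) (hg : g ∈ G) :
      HasSum (fun n => ⟪f, c • φ n⟫_ℂ * ⟪d • Ψ n, g⟫_ℂ) ⟪f, g⟫_ℂ := by
    have hdc : c * conj d = 1 := by simpa using congrArg conj hcd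
    convert! h.hasSum_left f hf g hg using 2 with n
    rw [inner_smul_left, inner_smul_right, mul_mul_mul_comm, hdc, one_mul]
  exact ⟨h.dense, fun n => G.smul_mem c (h.mem_left n), fun n => G.smul_mem d (h.mem_right n),
    fun f hf g hg => hsum hf hg, fun f hf g hg => hasSum_inner_mul_inner_swap (hsum hg hf)⟩

end QuasiBases

end Exponential

section States

variable {A B s t : ℝ} {T : Hil →ₗ.[ℂ] Hil}

theorem IsExp.mem_graph_of_isEvolution (h : IsExp (exponent A B s t).closure T)
    {f : ℝ → 𝓢(Plane, ℂ)} (hf : IsEvolution (expS (alpha A B s t)) f) (τ : ℝ) :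
    (incl (f τ), incl (f (τ + 1))) ∈ T.graph := by
  refine h.mem_graph_of_hasDerivAt hf.hasDerivAt_incl (fun τ => ?_) τ
  rw [exponent_eq]
  exact LinearPMap.le_graph_of_le (LinearPMap.le_closure _) (acts_toPMap _ _)

/-- The curve of states `e^{τ K} χ_n`, where `K` is the exponent of `T`; up to constants, `φ_n` and
`Ψ_n` are its values at `τ = 1` and `τ = -1`. -/
def stateCurve (A B s t : ℝ) (n : ℕ × ℕ) (τ : ℝ) : Hil :=
  (ladderConst n * ((1 / Real.sqrt Real.pi : ℝ) : ℂ)) • incl (ladderCurve A B s t n τ)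

/-- The factor of the Gaussian `exp (-½ (x₁² + x₂²) - τ (α₁ x₁ + α₂ x₂))` in `e^{τ K} χ_{0,0}`,
where `K` is the exponent of `T`. -/
def vacConst (A B s t τ : ℝ) : ℂ :=
  ((1 / Real.sqrt Real.pi : ℝ) : ℂ) *
    cexp (-I * (τ ^ 2 / 2 * imDot (alpha A B s t) (alpha A B s t)))

theorem vacConst_ne_zero (A B s t τ : ℝ) : vacConst A B s t τ ≠ 0 :=
  mul_ne_zero (ofReal_ne_zero.mpr (by positivity)) (Complex.exp_ne_zero _)

theorem vacConst_neg_one (A B s t : ℝ) : vacConst A B s t (-1) = vacConst A B s t 1 := by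
  simp [vacConst]

theorem ladder_smul_gauss {A' : Fin 2 → Hil →ₗ.[ℂ] Hil} {τ : ℝ}
    (hA : ∀ j, Acts (A' j) (creCurve A B s t τ j)) (M : ℂ) (n : ℕ × ℕ) :
    ladder A' (M • gauss ((τ : ℂ) • alpha A B s t)) n =
      (M / vacConst A B s t τ) • stateCurve A B s t n τ := by
  rw [← incl_gS, ladder_smul_incl hA, ladder_incl hA, stateCurve, ladderCurve, gaussCurve, vacConst]
  simp only [map_smul, smul_smul]
  congr 1
  field_simp

theorem phi_eq (M : ℂ) (n : ℕ × ℕ) :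
    phi A B s t M n = (M / vacConst A B s t 1) • stateCurve A B s t n 1 := by
  have hb (j : Fin 2) : Acts (b A B s t j) (creCurve A B s t 1 j) := by
    convert acts_b A B s t j using 1
    rw [creCurve, ofReal_one, one_mul, neg_div, neg_smul, sub_eq_add_neg]
  simpa only [phi, phi0, ofReal_one, one_smul] using ladder_smul_gauss hb M n

theorem psi_eq (M : ℂ) (n : ℕ × ℕ) :
    psi A B s t M n = (M / vacConst A B s t 1) • stateCurve A B s t n (-1) := by
  have ha (j : Fin 2) : Acts (a A B s t j).adjoint (creCurve A B s t (-1) j) := by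
    convert acts_a_adjoint A B s t j using 1
    rw [creCurve, ofReal_neg, ofReal_one, neg_one_mul, neg_smul, sub_neg_eq_add]
  simpa only [psi, psi0, ofReal_neg, ofReal_one, neg_one_smul, vacConst_neg_one] using
    ladder_smul_gauss ha M n

theorem stateCurve_zero (n : ℕ × ℕ) : stateCurve A B s t n 0 = chi n := by
  simp [stateCurve, ladderCurve, creCurve, gaussCurve, chi_eq, oscS]

theorem phi_zero (M : ℂ) : phi A B s t M 0 = phi0 A B s t M := by simp [phi, ladder]

theorem psi_zero (M : ℂ) : psi A B s t M 0 = psi0 A B s t M := by simp [psi, ladder]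

theorem phi_mem_schwartzD (M : ℂ) (n : ℕ × ℕ) : phi A B s t M n ∈ schwartzD := by
  rw [phi, phi0, ← incl_gS, ← map_smul]
  exact ladder_incl_mem (acts_b A B s t) _ n

theorem psi_mem_schwartzD (M : ℂ) (n : ℕ × ℕ) : psi A B s t M n ∈ schwartzD := by
  rw [psi, psi0, ← incl_gS, ← map_smul]
  exact ladder_incl_mem (acts_a_adjoint A B s t) _ n

theorem chi0_mem_schwartzD : chi0 ∈ schwartzD := chi0_eq ▸ incl_mem _

section Vacua

theorem ev_a_phi0 (M : ℂ) (j : Fin 2) : ev (a A B s t j) (phi0 A B s t M) = 0 := by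
  have hann := annS_gS_smul_alpha A B s t 1 j
  rw [one_smul, one_mul] at hann
  rw [phi0, ← incl_gS, ← map_smul, (acts_a A B s t j).ev_incl, map_smul, add_apply, hann,
    smul_apply, one_apply_eq_self, ← add_smul, neg_add_cancel, zero_smul, smul_zero, map_zero]

theorem ev_b_adjoint_psi0 (M : ℂ) (j : Fin 2) :
    ev (b A B s t j).adjoint (psi0 A B s t M) = 0 := by
  have hann := annS_gS_smul_alpha A B s t (-1) j
  rw [neg_one_smul, neg_one_mul] at hann
  rw [psi0, ← incl_gS, ← map_smul, (acts_b_adjoint A B s t j).ev_incl, map_smul, add_apply, hann,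
    smul_apply, one_apply_eq_self, ← add_smul, neg_add_cancel, zero_smul, smul_zero, map_zero]

theorem exists_ev_b_ne_ev_a_adjoint {j : Fin 2} (hk : kc A B s t j ≠ 0) :
    ∃ f ∈ schwartzD, ev (b A B s t j) f ≠ ev (a A B s t j).adjoint f := by
  refine ⟨incl (gS 0), incl_mem _, fun h => hk ?_⟩
  rw [(acts_b A B s t j).ev_incl, (acts_a_adjoint A B s t j).ev_incl] at h
  have h0 := congrArg (fun f : 𝓢(Plane, ℂ) => f 0) (incl_injective h)
  simp only [add_apply, smul_apply, one_apply_eq_self, gS_apply, smul_eq_mul] at h0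
  have hmul : conj (kc A B s t j) * gaussFun 0 0 = 0 := by linear_combination -h0
  exact (map_eq_zero _).mp ((mul_eq_zero.mp hmul).resolve_right (Complex.exp_ne_zero _))

end Vacua

namespace IsExp

theorem mem_graph_stateCurve (h : IsExp (exponent A B s t).closure T) (n : ℕ × ℕ) (τ : ℝ) :
    (stateCurve A B s t n τ, stateCurve A B s t n (τ + 1)) ∈ T.graph :=
  T.graph.smul_mem _ (h.mem_graph_of_isEvolution (isEvolution_ladderCurve A B s t n) τ)

theorem mem_graph_chi_stateCurve (h : IsExp (exponent A B s t).closure T) (n : ℕ × ℕ) :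
    (chi n, stateCurve A B s t n 1) ∈ T.graph := by
  simpa only [stateCurve_zero, zero_add] using h.mem_graph_stateCurve n 0

theorem mem_graph_stateCurve_chi (h : IsExp (exponent A B s t).closure T) (n : ℕ × ℕ) :
    (stateCurve A B s t n (-1), chi n) ∈ T.graph := by
  simpa only [stateCurve_zero, neg_add_cancel] using h.mem_graph_stateCurve n (-1)

theorem chi_mem_domain (h : IsExp (exponent A B s t).closure T) (n : ℕ × ℕ) :
    chi n ∈ T.domain ⊓ T.inverse.domain :=
  h.mem_domain_inf_inverse_domain (h.mem_graph_stateCurve_chi n) (h.mem_graph_chi_stateCurve n)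

theorem ev_chi (h : IsExp (exponent A B s t).closure T) (n : ℕ × ℕ) :
    ev T (chi n) = stateCurve A B s t n 1 := ev_of_mem_graph (h.mem_graph_chi_stateCurve n)

theorem ev_inverse_chi (h : IsExp (exponent A B s t).closure T) (n : ℕ × ℕ) :
    ev T.inverse (chi n) = stateCurve A B s t n (-1) :=
  ev_of_mem_graph (h.mem_graph_inverse (h.mem_graph_stateCurve_chi n))

theorem phi_eq_smul_ev (h : IsExp (exponent A B s t).closure T) (M : ℂ) (n : ℕ × ℕ) :
    phi A B s t M n = (M / vacConst A B s t 1) • ev T (chi n) := by rw [h.ev_chi, phi_eq]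

theorem psi_eq_smul_ev (h : IsExp (exponent A B s t).closure T) (M : ℂ) (n : ℕ × ℕ) :
    psi A B s t M n = (M / vacConst A B s t 1) • ev T.inverse (chi n) := by
  rw [h.ev_inverse_chi, psi_eq]

theorem inner_phi_psi (h : IsExp (exponent A B s t).closure T) (M M' : ℂ) (n m : ℕ × ℕ) :
    ⟪phi A B s t M n, psi A B s t M' m⟫_ℂ =
      conj (M / vacConst A B s t 1) * (M' / vacConst A B s t 1) * if n = m then 1 else 0 := by
  rw [phi_eq, psi_eq, inner_smul_left, inner_smul_right,
    h.inner_symm (h.mem_graph_chi_stateCurve n) (h.mem_graph_stateCurve_chi m),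
    orthonormal_iff_ite.mp orthonormal_chi, mul_assoc]

theorem inner_phi0_psi0 (h : IsExp (exponent A B s t).closure T) (M M' : ℂ) :
    ⟪phi0 A B s t M, psi0 A B s t M'⟫_ℂ =
      conj (M / vacConst A B s t 1) * (M' / vacConst A B s t 1) := by
  rw [← phi_zero, ← psi_zero, h.inner_phi_psi, if_pos rfl, mul_one]

theorem exists_phi_eq_ev (h : IsExp (exponent A B s t).closure T) :
    ∃ M M' : ℂ, ⟪phi0 A B s t M, psi0 A B s t M'⟫_ℂ = 1 ∧
      ∀ n, phi A B s t M n = ev T (chi n) ∧ psi A B s t M' n = ev T.inverse (chi n) := by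
  have hone : vacConst A B s t 1 / vacConst A B s t 1 = 1 := div_self (vacConst_ne_zero A B s t 1)
  refine ⟨vacConst A B s t 1, vacConst A B s t 1, ?_, fun n => ⟨?_, ?_⟩⟩
  · rw [h.inner_phi0_psi0, hone, map_one, one_mul]
  · rw [h.phi_eq_smul_ev, hone, one_smul]
  · rw [h.psi_eq_smul_ev, hone, one_smul]

variable {M M' : ℂ}

theorem exists_phi_eq_smul_ev (h : IsExp (exponent A B s t).closure T)
    (hM : ⟪phi0 A B s t M, psi0 A B s t M'⟫_ℂ = 1) :
    ∃ c : ℂ, c ≠ 0 ∧ ∀ n, phi A B s t M n = c • ev T (chi n) ∧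
      psi A B s t M' n = (conj c)⁻¹ • ev T.inverse (chi n) := by
  rw [h.inner_phi0_psi0] at hM
  refine ⟨M / vacConst A B s t 1, ?_, fun n => ⟨h.phi_eq_smul_ev M n, ?_⟩⟩
  · exact fun hzero => left_ne_zero_of_mul_eq_one hM (by rw [hzero, map_zero])
  · rw [inv_eq_of_mul_eq_one_right hM, h.psi_eq_smul_ev]

theorem biorthonormal (h : IsExp (exponent A B s t).closure T)
    (hM : ⟪phi0 A B s t M, psi0 A B s t M'⟫_ℂ = 1) (n m : ℕ × ℕ) :
    ⟪phi A B s t M n, psi A B s t M' m⟫_ℂ = if n = m then 1 else 0 := by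
  rw [h.inner_phi_psi, ← h.inner_phi0_psi0, hM, one_mul]

theorem isQuasiBases_phi_psi (h : IsExp (exponent A B s t).closure T)
    (hM : ⟪phi0 A B s t M, psi0 A B s t M'⟫_ℂ = 1) :
    IsQuasiBases (T.domain ⊓ T.inverse.domain) (phi A B s t M) (psi A B s t M') := by
  let e : HilbertBasis (ℕ × ℕ) ℂ Hil :=
    HilbertBasis.mk orthonormal_chi topologicalClosure_span_chi.ge
  have he (n : ℕ × ℕ) : e n = chi n := congrFun (HilbertBasis.coe_mk _ _) n
  have hstates : IsQuasiBases (T.domain ⊓ T.inverse.domain)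
      (fun n => stateCurve A B s t n 1) (fun n => stateCurve A B s t n (-1)) := by
    refine h.isQuasiBases e (fun n => ?_) (fun n => ?_) (fun n => ?_) fun n => ?_
    · exact he n ▸ h.mem_graph_chi_stateCurve n
    · exact he n ▸ h.mem_graph_stateCurve_chi n
    · exact LinearPMap.mem_domain_of_mem_graph (h.mem_graph_stateCurve n 1)
    · have hgraph := h.mem_graph_inverse (h.mem_graph_stateCurve n (-1 - 1))
      rw [sub_add_cancel] at hgraph
      exact LinearPMap.mem_domain_of_mem_graph hgraph
  rw [h.inner_phi0_psi0] at hM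
  rw [show phi A B s t M = _ from funext (phi_eq M), show psi A B s t M' = _ from
    funext (psi_eq M')]
  exact hstates.smul hM

end IsExp

end States

section Unbounded

theorem norm_sq_gauss (β : Fin 2 → ℂ) :
    ‖gauss β‖ ^ 2 = Real.pi * Real.exp ((β 0).re ^ 2 + (β 1).re ^ 2) := by
  have hexp : ((conj (β 0) + β 0) ^ 2 + (conj (β 1) + β 1) ^ 2) / 4 =
      ((β 0).re : ℂ) ^ 2 + ((β 1).re : ℂ) ^ 2 := by
    rw [add_comm (conj (β 0)), add_comm (conj (β 1)), add_conj, add_conj]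
    push_cast
    ring
  have hinner := inner_gauss β β
  rw [inner_self_eq_norm_sq_to_K, hexp] at hinner
  refine ofReal_injective ?_
  push_cast
  exact hinner

theorem norm_sq_gaussCurve (β : Fin 2 → ℂ) (τ : ℝ) : ‖incl (gaussCurve β τ)‖ ^ 2 =
    Real.pi * Real.exp (τ ^ 2 * (‖β 0‖ ^ 2 + ‖β 1‖ ^ 2)) := by
  have hphase : (-I * (τ ^ 2 / 2 * imDot β β)).re =
      τ ^ 2 / 2 * ((β 0).im ^ 2 + (β 1).im ^ 2) := by
    rw [show -I * (τ ^ 2 / 2 * imDot β β) = ((τ ^ 2 / 2 : ℝ) : ℂ) * (-I * imDot β β) by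
      push_cast; ring, re_ofReal_mul]
    simp [imDot, sq]
  rw [gaussCurve, map_smul, norm_smul, mul_pow, incl_gS, norm_sq_gauss, Complex.norm_exp, hphase,
    ← Real.exp_nat_mul, mul_left_comm, ← Real.exp_add]
  simp only [Pi.smul_apply, smul_eq_mul, re_ofReal_mul, Complex.sq_norm, normSq_apply]
  push_cast
  ring_nf

theorem alpha_ne_zero {A B : ℝ} (h : (A, B) ≠ (0, 0)) (s t : ℝ) : alpha A B s t ≠ 0 := by
  intro hzero
  have hre0 : 0 = -(A * (1 - t / 2)) + B * (s / 2 - 1) := by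
    simpa [hzero, kc] using congrArg re (alpha_add_I_mul A B s t)
  have him0 : 0 = A * (1 - t / 2) + B * (s / 2 - 1) := by
    simpa [hzero, kc] using congrArg im (alpha_add_I_mul A B s t)
  have hre1 : 0 = A * (1 + t / 2) + B * (s / 2 + 1) := by
    simpa [hzero, kc] using congrArg re (neg_I_mul_alpha_sub A B s t)
  have him1 : 0 = -(A * (1 + t / 2)) + B * (s / 2 + 1) := by
    simpa [hzero, kc] using congrArg im (neg_I_mul_alpha_sub A B s t)
  exact h (Prod.ext (by simp only; linarith) (by simp only; linarith))

theorem IsExp.not_bounded {A B s t : ℝ} {T : Hil →ₗ.[ℂ] Hil}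
    (h : IsExp (exponent A B s t).closure T) (hAB : (A, B) ≠ (0, 0)) :
    ¬∃ C : ℝ, ∀ f : T.domain, ‖T f‖ ≤ C * ‖(f : Hil)‖ := by
  rintro ⟨C, hC⟩
  set r := ‖alpha A B s t 0‖ ^ 2 + ‖alpha A B s t 1‖ ^ 2 with hr
  have hpos : 0 < r := by
    refine lt_of_le_of_ne (by positivity) fun hzero => alpha_ne_zero hAB s t ?_
    obtain ⟨h0, h1⟩ := (add_eq_zero_iff_of_nonneg (sq_nonneg _) (sq_nonneg _)).mp hzero.symm
    exact funext (Fin.forall_fin_two.mpr ⟨by simpa using h0, by simpa using h1⟩)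
  have hgrowth (τ : ℝ) : Real.exp ((2 * τ + 1) * r) ≤ C ^ 2 := by
    obtain ⟨y, hy, hTy⟩ := (LinearPMap.mem_graph_iff _).mp
      (h.mem_graph_of_isEvolution (isEvolution_gaussCurve _) τ)
    have hsq := pow_le_pow_left₀ (norm_nonneg _) (hC y) 2
    rw [hy, hTy, mul_pow, norm_sq_gaussCurve, norm_sq_gaussCurve, ← hr,
      show (τ + 1) ^ 2 * r = (2 * τ + 1) * r + τ ^ 2 * r by ring, Real.exp_add,
      mul_left_comm] at hsq
    exact le_of_mul_le_mul_right hsq (by positivity)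
  have hlarge := (Real.add_one_le_exp _).trans (hgrowth ((C ^ 2 / r - 1) / 2))
  rw [mul_div_cancel₀ _ two_ne_zero, sub_add_cancel, div_mul_cancel₀ _ hpos.ne'] at hlarge
  linarith

end Unbounded

end NCPB

end

theorem mainTheorem3 (A B : ℝ) :
    -- the model, up to terms of order at least two in `θ`, `θ̃`
    (∀ j k, NCPB.EqModQuadratic
        (fun s t => NCPB.xHat s j * NCPB.pHat t k - NCPB.pHat t k * NCPB.xHat s j)
        (fun _ _ => if j = k then Complex.I • 1 else 0)) ∧
    (∀ j k, NCPB.EqModQuadratic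
        (fun s _ => NCPB.xHat s j * NCPB.xHat s k - NCPB.xHat s k * NCPB.xHat s j)
        (fun s _ => (Complex.I * (s : ℂ) * NCPB.eps j k) • 1)) ∧
    (∀ j k, NCPB.EqModQuadratic
        (fun _ t => NCPB.pHat t j * NCPB.pHat t k - NCPB.pHat t k * NCPB.pHat t j)
        (fun _ t => (Complex.I * (t : ℂ) * NCPB.eps j k) • 1)) ∧
    NCPB.EqModQuadratic (NCPB.hHat A B) (NCPB.hTrunc A B) ∧
    NCPB.EqModQuadratic (NCPB.hHat A B) (NCPB.hNumber A B) ∧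
    -- the pseudo-bosonic structure
    ∀ s t : ℝ,
      NCPB.IsPseudoBosonic NCPB.schwartzD (NCPB.a A B s t) (NCPB.b A B s t) ∧
      (∀ j, NCPB.kc A B s t j ≠ 0 → ∃ f ∈ NCPB.schwartzD,
        NCPB.ev (NCPB.b A B s t j) f ≠ NCPB.ev (NCPB.a A B s t j).adjoint f) ∧
      (∀ M M' : ℂ,
        (∀ j, NCPB.ev (NCPB.a A B s t j) (NCPB.phi0 A B s t M) = 0) ∧
        (∀ j, NCPB.ev (NCPB.b A B s t j).adjoint (NCPB.psi0 A B s t M') = 0) ∧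
        ∀ n, NCPB.phi A B s t M n ∈ NCPB.schwartzD ∧ NCPB.psi A B s t M' n ∈ NCPB.schwartzD) ∧
      -- the orthonormal basis `χ`
      NCPB.IsPseudoBosonic NCPB.schwartzD NCPB.cgd (fun j => (NCPB.cgd j).adjoint) ∧
      NCPB.chi0 ∈ NCPB.schwartzD ∧ (∀ j, NCPB.ev (NCPB.cgd j) NCPB.chi0 = 0) ∧
      Orthonormal ℂ NCPB.chi ∧
      (Submodule.span ℂ (Set.range NCPB.chi)).topologicalClosure = ⊤ ∧
      -- the operator `T`
      IsSelfAdjoint (NCPB.exponent A B s t).closure ∧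
      (∃ T, NCPB.IsExp (NCPB.exponent A B s t).closure T) ∧
      ∀ T, NCPB.IsExp (NCPB.exponent A B s t).closure T →
        IsSelfAdjoint T ∧ LinearMap.ker T.toFun = ⊥ ∧
        ((A, B) ≠ (0, 0) → ¬ ∃ C : ℝ, ∀ f : T.domain, ‖T f‖ ≤ C * ‖(f : NCPB.Hil)‖) ∧
        (∀ n, NCPB.chi n ∈ T.domain ⊓ T.inverse.domain) ∧
        -- for a suitable choice of the normalization constants
        (∃ M M' : ℂ, inner ℂ (NCPB.phi0 A B s t M) (NCPB.psi0 A B s t M') = 1 ∧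
          ∀ n, NCPB.phi A B s t M n = NCPB.ev T (NCPB.chi n) ∧
            NCPB.psi A B s t M' n = NCPB.ev T.inverse (NCPB.chi n)) ∧
        -- for every choice of the normalization constants
        ∀ M M' : ℂ, inner ℂ (NCPB.phi0 A B s t M) (NCPB.psi0 A B s t M') = 1 →
          (∃ c : ℂ, c ≠ 0 ∧ ∀ n, NCPB.phi A B s t M n = c • NCPB.ev T (NCPB.chi n) ∧
            NCPB.psi A B s t M' n =
              ((starRingEnd ℂ) c)⁻¹ • NCPB.ev T.inverse (NCPB.chi n)) ∧
          (∀ n m, inner ℂ (NCPB.phi A B s t M n) (NCPB.psi A B s t M' m) =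
            if n = m then 1 else 0) ∧
          NCPB.IsQuasiBases (T.domain ⊓ T.inverse.domain)
            (NCPB.phi A B s t M) (NCPB.psi A B s t M') := by
  refine ⟨NCPB.eqModQuadratic_comm_xHat_pHat,
    fun j k => NCPB.eqModQuadratic_of_eq fun s _ => NCPB.comm_xHat s j k,
    fun j k => NCPB.eqModQuadratic_of_eq fun _ t => NCPB.comm_pHat t j k,
    NCPB.eqModQuadratic_hHat_hTrunc A B, NCPB.eqModQuadratic_hHat_hNumber A B, fun s t => ?_⟩
  obtain ⟨hclosure, hexp⟩ := NCPB.exists_isExp_exponent A B s t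
  refine ⟨NCPB.isPseudoBosonic_ab A B s t, fun _ => NCPB.exists_ev_b_ne_ev_a_adjoint,
    fun M M' => ⟨NCPB.ev_a_phi0 M, NCPB.ev_b_adjoint_psi0 M', fun n =>
      ⟨NCPB.phi_mem_schwartzD M n, NCPB.psi_mem_schwartzD M' n⟩⟩,
    NCPB.isPseudoBosonic_cgd, NCPB.chi0_mem_schwartzD, NCPB.ev_cgd_chi0, NCPB.orthonormal_chi,
    NCPB.topologicalClosure_span_chi, hclosure, hexp, fun T hT => ?_⟩
  exact ⟨hT.isSelfAdjoint, hT.ker_eq_bot, hT.not_bounded, hT.chi_mem_domain, hT.exists_phi_eq_ev,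
    fun M M' hM => ⟨hT.exists_phi_eq_smul_ev hM, hT.biorthonormal hM, hT.isQuasiBases_phi_psi hM⟩⟩
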